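/- **Model.** There are $n\ge 1$ experts and $T\ge 1$ days. On day $t$ expert $e$ makes a prediction $x_t(e)\in[0,1]$ and incurs a loss $\ell_t(e)\in[0,1]$. The predictions and losses are fixed in advance by an oblivious adversary. A word of memory holds $\lfloor\log_2(nT)\rfloor+1$ bits. A randomized algorithm keeps a memory state consisting of finitely many words, and this is all it remembers from one day to the next. Its initial state is drawn using random bits. On each day $t$ the words of its memory state include the names of a set $E_t$ of experts; the algorithm observes the predictions of the experts in $E_t$, follows some expert $i_t\in E_t$, then observes the losses of the experts in $E_t$, and updates its memory state, where both choices may use fresh independent fair random bits, which are not charged to the memory. The algorithm uses space at most $M$ if, for all predictions, all losses and all outcomes of its random bits, its memory state never consists of more than $M$ words. Its regret is $$\mathrm{Regret}=\sum_{t=1}^{T}\ell_t(i_t)-\min_{e}\sum_{t=1}^{T}\ell_t(e).$$ **Theorem.** Let $\delta\in(0,1)$. There is a family of such algorithms $A_{n,T}$ (for all integers $n,T\ge 1$) such that for every constant $c\in\mathbb N$ the following hold. 1. There are constants $C$ and $K$, depending only on $\delta$ and $c$, such that for all $n,T\ge1$ with $T\le n^{c}$, the algorithm $A_{n,T}$ uses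 space at most $C\,n^{\delta}\,(1+\log(nT))^{K}$. 2. For every constant $\gamma\in\mathbb N$ there are constants $C$ and $K$, depending only on $\delta$, $c$ and $\gamma$, such that for all $n,T\ge1$ with $T\le n^{c}$ and every sequence of predictions and losses fixed in advance, with probability at least $1-T^{-\gamma}$ over its random bits $A_{n,T}$ has $$\mathrm{Regret}\le C\,n^{2}\,T^{1/(1+\delta)}\,(1+\log(nT))^{K}.$$ -/

import Mathlib

/-- A word of memory, holding `⌊log₂ (n T)⌋ + 1` bits.  Constant factors in the word length are
absorbed in the number of words. -/
abbrev Word (n T : ℕ) : Type := Fin (2 ^ (Nat.log 2 (n * T) + 1))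

/-- A randomized algorithm for the online experts problem with `n` experts and `T` days in the
bounded-memory query model.

A memory state is a list of words (`words` is injective: nothing but the content of the words is
remembered from one day to the next; even the number of the day has to be stored).  The words of the state at
the beginning of a day contain the names of all experts that are queried on that day.  On each day
the algorithm sees the predictions of the queried experts, follows one of them, sees the losses of
the queried experts, and moves to a new memory state.  It has `numBits` fresh random bits for
the initialization and for each day; the random bits are not charged to the memory, and those of
a day can be consulted later only as far as they were written to memory. -/
structure ExpertAlgorithm (n T : ℕ) where
  /-- the memory states -/
  State : Type
  /-- the words of memory that make up a state -/
  words : State → List (Word n T)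
  words_injective : Function.Injective words
  /-- the experts queried on a day that starts in a given state -/
  query : State → Finset (Fin n)
  query_stored : ∀ s, ∀ e ∈ query s, ∃ w ∈ words s, w.val = e.val
  /-- the number of random bits drawn at initialization and on each day -/
  numBits : ℕ
  /-- the random initial state -/
  init : (Fin numBits → Bool) → State
  /-- the expert followed, given the state, the predictions of the queried experts and the
  random bits of the day -/
  play : (s : State) → ({e // e ∈ query s} → unitInterval) →
    (Fin numBits → Bool) → {e // e ∈ query s}
  /-- the next state, given the state, the predictions and the losses of the queried experts and
  the random bits of the day -/
  update : (s : State) → ({e // e ∈ query s} → unitInterval) → ({e // e ∈ query s} → unitInterval) →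
    (Fin numBits → Bool) → State

namespace ExpertAlgorithm

variable {n T : ℕ} (A : ExpertAlgorithm n T)

/-- All random bits of a run: block `0` serves the initialization, block `t.succ` serves day `t`. -/
abbrev Tape : Type := Fin (T + 1) → Fin A.numBits → Bool

/-- The memory state after `t` days, when expert `e` predicts `x t e` and incurs
loss `l t e` on day `t`. -/
def state (x l : Fin T → Fin n → unitInterval) (ω : A.Tape) : Fin (T + 1) → A.State :=
  Fin.induction (motive := fun _ => A.State) (A.init (ω 0))
    (fun t s => A.update s (fun e => x t e.1) (fun e => l t e.1) (ω t.succ))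

/-- The expert followed on day `t`. -/
def played (x l : Fin T → Fin n → unitInterval) (ω : A.Tape) (t : Fin T) : Fin n :=
  (A.play (A.state x l ω t.castSucc) (fun e => x t e.1) (ω t.succ)).1

/-- Total loss of the algorithm minus the total loss of the best expert in hindsight. -/
noncomputable def regret (x l : Fin T → Fin n → unitInterval) (ω : A.Tape) : ℝ :=
  (∑ t, (l t (A.played x l ω t) : ℝ)) - ⨅ i : Fin n, ∑ t, (l t i : ℝ)

/-- The algorithm never occupies more than `M` words, whatever the input and the random bits. -/
def SpaceAtMost (M : ℝ) : Prop :=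
  ∀ (x l : Fin T → Fin n → unitInterval) (ω : A.Tape) (t : Fin (T + 1)),
    ((A.words (A.state x l ω t)).length : ℝ) ≤ M

/-- The probability of an event over uniformly random independent bits. -/
noncomputable def prob (S : Set A.Tape) : ℝ :=
  (PMF.uniformOfFintype A.Tape).toMeasure.real S

end ExpertAlgorithm

/-! ### Supermartingale bounds by counting on finite product spaces. -/

section Resampling

open Finset Function

variable {κ U : Type*} [Fintype κ] [DecidableEq κ] [Fintype U]

/-! Put `q = ⌈n^δ⌉` and `N = n q`, and measure losses in integer units of `1 / T`. The algorithm is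
a tower of `k = Nat.log N T` levels above the trivial strategy that always follows expert 0.
Strategy `j + 1` improves strategy `j`: it works in epochs of `E j = N^(j+1)` days, and `N` epochs
form an instance, which is one epoch for the next level. It keeps a pool of experts, lets one nearly
uniform random expert join at each epoch, and in each epoch runs exponential weights on strategy `j`
together with the pool. It therefore does almost as well as strategy `j` improved by the best gain
in the pool, where the gain of an expert in an epoch is its improvement over strategy `j`, cut off
to lie between `0` and `R j`. The cutoff loses nothing against a comparator over which strategy `j`
has regret at most `R j` per epoch.

An entry is evicted once its total gain since joining exceeds the total best gain of the older
entries by at most `R / q` per epoch. The fate of an entry thus depends only on older entries, and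
this has two consequences. The pool is small (`Tracks.length_mul_le`, `length_older_le`): a
surviving entry raised the best gain by more than `R / q` per epoch on average over its life. Since
`1 / age` is at most `1 / (s - τ)` for the epochs `τ` of that life, these increments, weighted by `1
/ (s - τ)`, telescope along the pool to a harmonic sum. So there are at most `q (1 + log N)` older
entries. The pool competes with any expert `i` (`sum_gain_le`): read the epochs from the left.
Either the older entries cover `i` on some interval starting at the current epoch, at the price of
the slack, and the interval is skipped; or `i` would survive to the end if it joined now. The latter
is a trial, and it is determined by earlier draws alone. If `i` is drawn, the pool contains `i` from
then on; otherwise at most `R` is lost. A trial succeeds with probability at least `1 / (2 n)`, so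
more than `2 n L²` failures have probability at most `exp (-L²)` (`card_le_failedTrials_le`).

Slack, failed trials and exponential weights together give `R (j + 1) = R j * n * 10 L²`, while
epochs grow by the factor `N ≥ n^(1+δ)` (`regret_step`, `sum_levelLoss_le`). After `k` levels one
epoch contains all `T` days, and the regret, in units of `1 / T`, is `R k = T N (10 n L²)^k`. As
`N^k ≤ T`, the factor `n^k` is at most `T^(1/(1+δ))`, and `N ≤ n²`.

The loss of a level is its expected loss rounded up, so it does not depend on the coins that select
the followed expert. Those coins cost another `√T` up to logarithms (`card_sum_gt_le`), which is
within the bound since `δ < 1`. For `T ≤ n^c` there are at most `c` levels, each with a pool of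
order `q` up to logarithms, whose counters have polylogarithmically many bits. -/

/-- Resampling one coordinate of a uniformly random function does not change its law. -/
theorem sum_sum_update (c : κ) (f : (κ → U) → ℝ) :
    ∑ ω, ∑ u, f (update ω c u) = Fintype.card U * ∑ ω, f ω := by
  have h : ∑ z : (κ → U) × U, f (update z.1 c z.2) = ∑ z : (κ → U) × U, f z.1 := by
    have hinv : Involutive (fun z : (κ → U) × U => (update z.1 c z.2, z.1 c)) := by
      rintro ⟨ω, u⟩
      simp
    exact Fintype.sum_equiv hinv.toPerm _ _ (fun z => rfl)
  rw [Fintype.sum_prod_type, Fintype.sum_prod_type] at h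
  rw [h]
  simp [Finset.mul_sum]

/-- One step of a supermartingale argument. -/
theorem sum_le_sum_of_resample [Nonempty U] (c : κ) (f g : (κ → U) → ℝ)
    (h : ∀ ω, ∑ u, g (update ω c u) ≤ Fintype.card U * f ω) : ∑ ω, g ω ≤ ∑ ω, f ω := by
  have hU : (0 : ℝ) < Fintype.card U := by exact_mod_cast Fintype.card_pos
  have := Finset.sum_le_sum (fun ω (_ : ω ∈ univ) => h ω)
  rw [sum_sum_update, ← Finset.mul_sum] at this
  exact le_of_mul_le_mul_left this hU

open scoped Classical in
/-- The number of trials `s < m` (times at which `D` holds) up to which no trial succeeded. -/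
noncomputable def failedTrials (c : ℕ → κ) (D : ℕ → (κ → U) → Prop) (good : U → Prop)
    (m : ℕ) (ω : κ → U) : ℕ :=
  #{s ∈ range m | D s ω ∧ ∀ r ≤ s, D r ω → ¬ good (ω (c r))}

-- Whether `s` is a trial is unaffected by resampling at active times from `s` on, so conditionally
-- on the past each trial fails with probability at most `1 - p`. The predicate `act` marks the
-- times at which `c` gives distinct coordinates.
open scoped Classical in
theorem card_le_failedTrials_le [Nonempty U] (N M : ℕ) (c : ℕ → κ) (act : ℕ → Prop)
    (D : ℕ → (κ → U) → Prop) (good : U → Prop) (p : ℝ) (hp1 : p ≤ 1)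
    (hgood : p * Fintype.card U ≤ #{u : U | good u})
    (hact : ∀ s ω, D s ω → act s)
    (hinj : ∀ s r, act s → act r → c s = c r → s = r)
    (hpred : ∀ s r ω u, s ≤ r → act r → (D s (update ω (c r) u) ↔ D s ω)) :
    (#{ω : κ → U | M ≤ failedTrials c D good N ω} : ℝ) ≤ (1 - p) ^ M * Fintype.card (κ → U) := by
  set alive : ℕ → (κ → U) → Prop := fun m ω => ∀ r < m, D r ω → ¬ good (ω (c r)) with halive
  have hsucc : ∀ m ω, failedTrials c D good (m + 1) ω =
      failedTrials c D good m ω + if D m ω ∧ alive (m + 1) ω then 1 else 0 := by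
    intro m ω
    simp only [failedTrials, halive, Nat.lt_succ_iff, range_add_one, filter_insert]
    split_ifs <;> simp
  have h1p : 0 ≤ 1 - p := by linarith
  -- An upper bound for the conditional probability of reaching `M` failures: `1` once they
  -- occurred, `0` after a success, and one factor `1 - p` for each missing failure otherwise. It is
  -- a supermartingale.
  set Z : ℕ → (κ → U) → ℝ := fun m ω =>
    if M ≤ failedTrials c D good m ω then 1 else
      if alive m ω then (1 - p) ^ (M - failedTrials c D good m ω) else 0 with hZ
  have hZ0 : ∀ ω, Z 0 ω = (1 - p) ^ M := by
    intro ω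
    have : failedTrials c D good 0 ω = 0 := by simp [failedTrials]
    simp only [hZ, this, halive]
    split_ifs with h h'
    · have : M = 0 := by omega
      simp [this]
    · simp
    · simp at h'
  have hupd : ∀ m r ω u, m ≤ r → act r → (∀ s < m, D s (update ω (c r) u) ∧ good (update ω (c r) u (c s)) ↔
      D s ω ∧ good (ω (c s))) := by
    intro m r ω u hm hr s hs
    rw [hpred s r ω u (by omega) hr]
    refine and_congr_right fun hD => ?_
    rw [update_of_ne]
    intro h
    have := hinj s r (hact s ω hD) hr h
    omega
  have haliveupd : ∀ m r ω u, m ≤ r → act r → (alive m (update ω (c r) u) ↔ alive m ω) := by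
    intro m r ω u hm hr
    simp only [halive]
    refine forall_congr' fun s => forall_congr' fun hs => ?_
    have := hupd m r ω u hm hr s hs
    tauto
  have hBupd : ∀ m r ω u, m ≤ r → act r →
      failedTrials c D good m (update ω (c r) u) = failedTrials c D good m ω := by
    intro m
    induction m with
    | zero => intros; simp [failedTrials]
    | succ m ih =>
      intro r ω u hm hr
      simp only [hsucc, ih r ω u (by omega) hr, haliveupd _ r ω u hm hr,
        hpred m r ω u (by omega) hr]
  have hZupd : ∀ m ω u, act m → Z m (update ω (c m) u) = Z m ω := by
    intro m ω u hm
    simp only [hZ, hBupd m m ω u le_rfl hm, haliveupd m m ω u le_rfl hm]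
  have haliveS : ∀ m ω, alive (m + 1) ω ↔ alive m ω ∧ (D m ω → ¬ good (ω (c m))) := by
    intro m ω
    simp only [halive, Nat.lt_succ_iff_lt_or_eq]
    constructor
    · intro h
      exact ⟨fun r hr => h r (Or.inl hr), h m (Or.inr rfl)⟩
    · rintro ⟨h1, h2⟩ r (hr | rfl)
      · exact h1 r hr
      · exact h2
  have hZnn : ∀ m ω, 0 ≤ Z m ω := by
    intro m ω
    simp only [hZ]
    split_ifs <;> positivity
  have hnoD : ∀ m ω, ¬ D m ω → Z (m + 1) ω = Z m ω := by
    intro m ω h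
    simp only [hZ, hsucc, haliveS, h]
    simp
  have hstep : ∀ m, ∑ ω, Z (m + 1) ω ≤ ∑ ω, Z m ω := by
    intro m
    by_cases hm : act m
    · apply sum_le_sum_of_resample (c m)
      intro ω
      by_cases hD : D m ω
      · by_cases hB : M ≤ failedTrials c D good m ω
        · have : ∀ u, Z (m + 1) (update ω (c m) u) ≤ 1 := by
            intro u
            simp only [hZ, hsucc]
            have := hBupd m m ω u le_rfl hm
            rw [if_pos (by omega)]
          have h2 : Z m ω = 1 := by simp only [hZ]; rw [if_pos hB]
          calc _ ≤ ∑ u : U, (1 : ℝ) := Finset.sum_le_sum fun u _ => this u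
            _ = _ := by rw [h2]; simp
        by_cases hA : alive m ω
        · have hu : ∀ u, Z (m + 1) (update ω (c m) u) =
              if ¬ good u then (1 - p) ^ (M - failedTrials c D good m ω - 1) else 0 := by
            intro u
            have hDu := (hpred m m ω u le_rfl hm).2 hD
            have hAu := (haliveupd m m ω u le_rfl hm).2 hA
            simp only [hZ, hsucc, haliveS, hBupd m m ω u le_rfl hm, hDu, hAu]
            simp only [update_self, true_and, true_implies]
            by_cases hg : good u
            · simp [hg, hB]
            · simp only [hg, not_false_eq_true, if_true]
              split_ifs with h
              · rw [show M - failedTrials c D good m ω - 1 = 0 by omega, pow_zero]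
              · congr 1
          have h2 : Z m ω = (1 - p) * (1 - p) ^ (M - failedTrials c D good m ω - 1) := by
            simp only [hZ]
            rw [if_neg hB, if_pos hA, ← pow_succ']
            congr 1
            omega
          simp only [hu]
          rw [← Finset.sum_filter, Finset.sum_const, nsmul_eq_mul, h2, ← mul_assoc]
          gcongr
          have h3 := Finset.card_filter_add_card_filter_not (s := (univ : Finset U)) (fun u => good u)
          have h4 : (#{u : U | good u} : ℝ) + #{u : U | ¬ good u} = Fintype.card U := by
            rw [← Finset.card_univ]; exact_mod_cast h3
          linarith
        · have hu : ∀ u, Z (m + 1) (update ω (c m) u) = 0 := by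
            intro u
            have hAu := (haliveupd m m ω u le_rfl hm).not.2 hA
            simp only [hZ, hsucc, haliveS, hBupd m m ω u le_rfl hm, hAu]
            simp [hB]
          simp only [hu, sum_const_zero]
          have := hZnn m ω
          positivity
      · have : ∀ u, Z (m + 1) (update ω (c m) u) = Z m ω := by
          intro u
          rw [hnoD, hZupd m ω u hm]
          rwa [hpred m m ω u le_rfl hm]
        simp [this]
    · refine Finset.sum_le_sum fun ω _ => ?_
      rw [hnoD]
      exact fun h => hm (hact m ω h)
  have hall : ∀ m, ∑ ω, Z m ω ≤ (1 - p) ^ M * Fintype.card (κ → U) := by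
    intro m
    induction m with
    | zero => simp only [hZ0]; simp [mul_comm]
    | succ m ih => exact (hstep m).trans ih
  refine le_trans ?_ (hall N)
  rw [Finset.card_filter]
  push_cast
  refine Finset.sum_le_sum fun ω _ => ?_
  split_ifs with h
  · simp [hZ, h]
  · exact hZnn N ω

open scoped Classical in
/-- Concentration of the sum of `T` bounded variables around an upper bound for their conditional
means. -/
theorem card_sum_gt_le [Nonempty U] (T : ℕ) (c : ℕ → κ) (Y a : ℕ → (κ → U) → ℝ) (lam r : ℝ)
    (hlam : 0 < lam) (hlam1 : lam ≤ 1)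
    (hY0 : ∀ t < T, ∀ ω, 0 ≤ Y t ω) (hY1 : ∀ t < T, ∀ ω, Y t ω ≤ 1)
    (ha : ∀ s t ω u, s ≤ t → t < T → a s (update ω (c t) u) = a s ω)
    (hY : ∀ s t ω u, s < t → t < T → Y s (update ω (c t) u) = Y s ω)
    (hmean : ∀ t < T, ∀ ω, ∑ u, Y t (update ω (c t) u) ≤ Fintype.card U * a t ω) :
    (#{ω : κ → U | ∑ t ∈ range T, a t ω + lam * T + r / lam < ∑ t ∈ range T, Y t ω} : ℝ) ≤
      Real.exp (-r) * Fintype.card (κ → U) := by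
  -- The exponential supermartingale; `lam ^ 2` per step pays for the quadratic term in `exp x ≤ 1 +
  -- x + x ^ 2` on `[-1, 1]`.
  set Z : ℕ → (κ → U) → ℝ := fun m ω =>
    Real.exp (lam * ∑ t ∈ range m, (Y t ω - a t ω) - lam ^ 2 * m) with hZ
  have hstep : ∀ m < T, ∑ ω, Z (m + 1) ω ≤ ∑ ω, Z m ω := by
    intro m hm
    apply sum_le_sum_of_resample (c m)
    intro ω
    have h1 : ∀ u, Z (m + 1) (update ω (c m) u) =
        Z m ω * Real.exp (-(lam * a m ω) - lam ^ 2) * Real.exp (lam * Y m (update ω (c m) u)) := by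
      intro u
      simp only [hZ]
      rw [← Real.exp_add, ← Real.exp_add, Finset.sum_range_succ, ha m m ω u le_rfl hm]
      have : ∑ t ∈ range m, (Y t (update ω (c m) u) - a t (update ω (c m) u)) =
          ∑ t ∈ range m, (Y t ω - a t ω) := by
        refine Finset.sum_congr rfl fun t ht => ?_
        have ht := Finset.mem_range.1 ht
        rw [ha t m ω u ht.le hm, hY t m ω u ht hm]
      rw [this]
      push_cast
      ring_nf
    have h2 : ∀ u, Real.exp (lam * Y m (update ω (c m) u)) ≤
        1 + lam * Y m (update ω (c m) u) + lam ^ 2 := by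
      intro u
      have y0 := hY0 m hm (update ω (c m) u)
      have y1 := hY1 m hm (update ω (c m) u)
      have hb : |lam * Y m (update ω (c m) u)| ≤ 1 := by
        rw [abs_of_nonneg (by positivity)]
        nlinarith
      have := (abs_le.1 (Real.abs_exp_sub_one_sub_id_le hb)).2
      have h3 : (lam * Y m (update ω (c m) u)) ^ 2 ≤ lam ^ 2 := by
        rw [mul_pow]
        have : Y m (update ω (c m) u) ^ 2 ≤ 1 := by nlinarith
        nlinarith [sq_nonneg lam]
      linarith
    have h3 : ∑ u, Real.exp (lam * Y m (update ω (c m) u)) ≤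
        Fintype.card U * Real.exp (lam * a m ω + lam ^ 2) := by
      calc _ ≤ ∑ u, (1 + lam * Y m (update ω (c m) u) + lam ^ 2) :=
            Finset.sum_le_sum fun u _ => h2 u
        _ = Fintype.card U * (1 + lam ^ 2) + lam * ∑ u, Y m (update ω (c m) u) := by
            rw [Finset.sum_add_distrib, Finset.sum_add_distrib, Finset.mul_sum]
            simp
            ring
        _ ≤ Fintype.card U * (1 + lam ^ 2) + lam * (Fintype.card U * a m ω) := by
            gcongr
            exact hmean m hm ω
        _ = Fintype.card U * ((lam * a m ω + lam ^ 2) + 1) := by ring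
        _ ≤ _ := by
            gcongr
            exact Real.add_one_le_exp _
    simp only [h1]
    rw [← Finset.mul_sum]
    calc _ ≤ Z m ω * Real.exp (-(lam * a m ω) - lam ^ 2) *
          (Fintype.card U * Real.exp (lam * a m ω + lam ^ 2)) := by
          gcongr
      _ = Fintype.card U * Z m ω * (Real.exp (-(lam * a m ω) - lam ^ 2) *
          Real.exp (lam * a m ω + lam ^ 2)) := by ring
      _ = _ := by
          rw [← Real.exp_add]
          simp
  have hall : ∀ m ≤ T, ∑ ω, Z m ω ≤ Fintype.card (κ → U) := by
    intro m
    induction m with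
    | zero => intro _; simp [hZ]
    | succ m ih => intro h; exact (hstep m (by omega)).trans (ih (by omega))
  have hT := hall T le_rfl
  have hkey : Real.exp r * #{ω : κ → U |
      ∑ t ∈ range T, a t ω + lam * T + r / lam < ∑ t ∈ range T, Y t ω} ≤ ∑ ω, Z T ω := by
    rw [Finset.card_filter]
    push_cast
    rw [Finset.mul_sum]
    refine Finset.sum_le_sum fun ω _ => ?_
    split_ifs with h
    · rw [mul_one]
      simp only [hZ]
      apply Real.exp_le_exp.2
      rw [Finset.sum_sub_distrib]
      have : lam * (∑ t ∈ range T, a t ω + lam * T + r / lam) <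
          lam * ∑ t ∈ range T, Y t ω := by gcongr
      rw [mul_add, mul_add, mul_div_cancel₀ _ hlam.ne'] at this
      nlinarith
    · simp only [mul_zero, hZ]
      positivity
  rw [Real.exp_neg, inv_mul_eq_div, le_div_iff₀ (Real.exp_pos r)]
  linarith

end Resampling

/-! ### The pool and its eviction rule. -/

/-- An expert in the pool: the number of completed epochs since it joined, its total gain and the
total gain of the older part of the pool over these epochs, and its loss in the current epoch. -/
@[ext]
structure Entry (n : ℕ) where
  expert : Fin n
  age : ℕ
  gain : ℕ
  bench : ℕ
  cur : ℕ

namespace Entry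

variable {n : ℕ}

/-- The entry of an expert that just joined. -/
def fresh (i : Fin n) : Entry n := ⟨i, 0, 0, 0, 0⟩

/-- The older part of the pool did almost as well as the entry. -/
def Covered (q R : ℕ) (e : Entry n) : Prop := q * e.gain ≤ q * e.bench + R * e.age

instance (q R : ℕ) : DecidablePred (Covered (n := n) q R) := fun e =>
  inferInstanceAs (Decidable (q * e.gain ≤ q * e.bench + R * e.age))

/-- Bookkeeping at the end of an epoch. -/
def record (g b : ℕ) (e : Entry n) : Entry n := ⟨e.expert, e.age + 1, e.gain + g, e.bench + b, 0⟩

end Entry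

namespace Pool

open Finset Entry

variable {n : ℕ}

/-- The largest gain in a pool. -/
def topGain (g : Entry n → ℕ) : List (Entry n) → ℕ
  | [] => 0
  | e :: l => max (g e) (topGain g l)

/-- The end of an epoch: the records are updated and the covered entries are evicted.  The pool is
listed from the youngest to the oldest entry. -/
def closeEpoch (q R : ℕ) (g : Entry n → ℕ) : List (Entry n) → List (Entry n)
  | [] => []
  | e :: l =>
    if (e.record (g e) (topGain g l)).Covered q R then closeEpoch q R g l
    else e.record (g e) (topGain g l) :: closeEpoch q R g l

theorem topGain_le_append (g : Entry n → ℕ) (l₁ l₂ : List (Entry n)) :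
    topGain g l₂ ≤ topGain g (l₁ ++ l₂) := by
  induction l₁ with
  | nil => simp
  | cons e l ih => simp only [List.cons_append, topGain]; omega

theorem le_topGain {g : Entry n → ℕ} {l : List (Entry n)} {e : Entry n} (he : e ∈ l) :
    g e ≤ topGain g l := by
  induction l with
  | nil => simp at he
  | cons a l ih =>
    simp only [topGain]
    rcases List.mem_cons.1 he with rfl | h
    · omega
    · have := ih h
      omega

theorem topGain_le {g : Entry n → ℕ} {l : List (Entry n)} {b : ℕ} (h : ∀ e ∈ l, g e ≤ b) :
    topGain g l ≤ b := by
  induction l with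
  | nil => simp [topGain]
  | cons a l ih =>
    simp only [topGain, max_le_iff]
    exact ⟨h a (by simp), ih fun e he => h e (by simp [he])⟩

theorem topGain_eq_zero_or_mem (g : Entry n → ℕ) (l : List (Entry n)) :
    topGain g l = 0 ∨ ∃ e ∈ l, topGain g l = g e := by
  induction l with
  | nil => simp [topGain]
  | cons a l ih =>
    simp only [topGain]
    rcases le_total (g a) (topGain g l) with h | h
    · rw [max_eq_right h]
      rcases ih with h0 | ⟨e, he, h1⟩
      · exact Or.inl h0
      · exact Or.inr ⟨e, by simp [he], h1⟩
    · rw [max_eq_left h]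
      exact Or.inr ⟨a, by simp, rfl⟩

theorem topGain_congr {g g' : Entry n → ℕ} {l : List (Entry n)} (h : ∀ e ∈ l, g e = g' e) :
    topGain g l = topGain g' l := by
  induction l with
  | nil => rfl
  | cons a l ih =>
    simp only [topGain]
    rw [h a (by simp), ih fun e he => h e (by simp [he])]

theorem topGain_map (g : Entry n → ℕ) (f : Entry n → Entry n) (l : List (Entry n)) :
    topGain g (l.map f) = topGain (fun e => g (f e)) l := by
  induction l with
  | nil => rfl
  | cons a l ih => simp only [List.map_cons, topGain, ih]

/-- Closing an epoch ignores the losses of the current epoch, except through the gains. -/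
theorem closeEpoch_map (q R : ℕ) (g : Entry n → ℕ) (f : Entry n → Entry n)
    (hf : ∀ e a b, (f e).record a b = e.record a b) (l : List (Entry n)) :
    closeEpoch q R g (l.map f) = closeEpoch q R (fun e => g (f e)) l := by
  induction l with
  | nil => rfl
  | cons a l ih => simp only [List.map_cons, closeEpoch, topGain_map, hf, ih]

theorem closeEpoch_congr (q R : ℕ) {g g' : Entry n → ℕ} {l : List (Entry n)}
    (h : ∀ e ∈ l, g e = g' e) : closeEpoch q R g l = closeEpoch q R g' l := by
  induction l with
  | nil => rfl
  | cons a l ih =>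
    have h' : ∀ e ∈ l, g e = g' e := fun e he => h e (by simp [he])
    simp only [closeEpoch]
    rw [h a (by simp), ih h', topGain_congr h']

theorem mem_closeEpoch {q R : ℕ} {g : Entry n → ℕ} {l : List (Entry n)} {e : Entry n}
    (he : e ∈ closeEpoch q R g l) :
    ¬ e.Covered q R ∧ ∃ e₀ ∈ l, ∃ b ≤ topGain g l, e = e₀.record (g e₀) b := by
  induction l with
  | nil => simp [closeEpoch] at he
  | cons a l ih =>
    have key : e ∈ closeEpoch q R g l → ¬ e.Covered q R ∧ ∃ e₀ ∈ a :: l,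
        ∃ b ≤ topGain g (a :: l), e = e₀.record (g e₀) b := by
      intro h
      obtain ⟨h1, e₀, h2, b, h3, h4⟩ := ih h
      exact ⟨h1, e₀, by simp [h2], b, by simp only [topGain]; omega, h4⟩
    simp only [closeEpoch] at he
    split_ifs at he with h
    · exact key he
    · rcases List.mem_cons.1 he with rfl | h'
      · exact ⟨h, a, by simp, _, by simp only [topGain]; omega, rfl⟩
      · exact key h'

/-- Eviction of an entry looks only at the entries behind it in the list, so the older part of a
pool evolves as if the younger entries were absent. The whole analysis rests on this autonomy. -/
theorem closeEpoch_append (q R : ℕ) (g : Entry n → ℕ) (l₁ l₂ : List (Entry n)) :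
    ∃ y, closeEpoch q R g (l₁ ++ l₂) = y ++ closeEpoch q R g l₂ := by
  induction l₁ with
  | nil => exact ⟨[], rfl⟩
  | cons a l ih =>
    obtain ⟨y, hy⟩ := ih
    simp only [List.cons_append, closeEpoch]
    split_ifs
    · exact ⟨y, hy⟩
    · exact ⟨_ :: y, by rw [hy]; rfl⟩

theorem topGain_closeEpoch_le (q R : ℕ) (g : Entry n → ℕ) (h : Fin n → ℕ) (l : List (Entry n)) :
    topGain (fun e => h e.expert) (closeEpoch q R g l) ≤ topGain (fun e => h e.expert) l := by
  refine topGain_le fun e he => ?_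
  obtain ⟨-, e₀, h0, b, -, rfl⟩ := mem_closeEpoch he
  exact le_topGain (g := fun e => h e.expert) (e := e₀) h0

/-! ### The pool over the epochs -/

section Dynamics

variable (q R : ℕ) (G : ℕ → Fin n → ℕ) (X : ℕ → Fin n)

/-- The pool at the beginning of epoch `s`, before the expert of this epoch joins, when expert `i`
has gain `G s i` in epoch `s` and `X s` joins at the beginning of epoch `s`. -/
def older : ℕ → List (Entry n)
  | 0 => []
  | s + 1 => closeEpoch q R (fun e => G s e.expert) (fresh (X s) :: older s)

/-- The pool during epoch `s`. -/
def pool (s : ℕ) : List (Entry n) := fresh (X s) :: older q R G X s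

/-- What becomes of the part `l` of the pool in the `r` epochs from `s` on. -/
def evolve (s : ℕ) (l : List (Entry n)) : ℕ → List (Entry n)
  | 0 => l
  | r + 1 => closeEpoch q R (fun e => G (s + r) e.expert) (evolve s l r)

theorem older_congr {X' : ℕ → Fin n} {s : ℕ} (h : ∀ r < s, X r = X' r) :
    older q R G X s = older q R G X' s := by
  induction s with
  | zero => rfl
  | succ s ih =>
    simp only [older]
    rw [h s (by omega), ih fun r hr => h r (by omega)]

/-- A suffix of the pool can be followed through later epochs without knowing who joins; its best
gain is then a lower bound for that of the actual pool. -/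
theorem exists_pool_eq_append (s : ℕ) (l : List (Entry n))
    (hl : ∃ y, pool q R G X s = y ++ l) (r : ℕ) :
    ∃ y, pool q R G X (s + r) = y ++ evolve q R G s l r := by
  induction r with
  | zero => exact hl
  | succ r ih =>
    obtain ⟨y, hy⟩ := ih
    obtain ⟨z, hz⟩ := closeEpoch_append q R (fun e => G (s + r) e.expert) y (evolve q R G s l r)
    refine ⟨fresh (X (s + r + 1)) :: z, ?_⟩
    rw [← add_assoc, pool, older, List.cons_append]
    congr 1
    rw [evolve, ← hz, ← hy]
    rfl

/-- In the epochs `s, …, s + r` the entries older than `s` did almost as well as expert `i`. -/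
def CoveredUpTo (i : Fin n) (s r : ℕ) : Prop :=
  q * ∑ τ ∈ range (r + 1), G (s + τ) i ≤
    q * ∑ τ ∈ range (r + 1), topGain (fun e => G (s + τ) e.expert)
      (evolve q R G s (older q R G X s) τ) + R * (r + 1)

/-- The sums compared in `CoveredUpTo` are exactly the counters that `i` would hold had it joined in
epoch `s`, so being uncovered at every stage means never being evicted. -/
theorem evolve_fresh_cons (i : Fin n) (s H : ℕ)
    (h : ∀ r < H, ¬ CoveredUpTo q R G X i s r) (r : ℕ) (hr : r ≤ H) :
    evolve q R G s (fresh i :: older q R G X s) r =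
      ⟨i, r, ∑ τ ∈ range r, G (s + τ) i, ∑ τ ∈ range r, topGain (fun e => G (s + τ) e.expert)
        (evolve q R G s (older q R G X s) τ), 0⟩ :: evolve q R G s (older q R G X s) r := by
  induction r with
  | zero => simp [evolve, fresh]
  | succ r ih =>
    have h1 := h r (by omega)
    simp only [CoveredUpTo, sum_range_succ _ r] at h1
    rw [evolve, ih (by omega), closeEpoch, if_neg]
    · simp only [evolve, record, sum_range_succ _ r]
    · simpa only [Covered, record] using h1

theorem gain_le_topGain_pool (i : Fin n) (s N : ℕ) (hX : X s = i)
    (h : ∀ r, s + r < N → ¬ CoveredUpTo q R G X i s r) (τ : ℕ) (hs : s ≤ τ) (hτ : τ < N) :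
    G τ i ≤ topGain (fun e => G τ e.expert) (pool q R G X τ) := by
  obtain ⟨r, rfl⟩ := Nat.exists_eq_add_of_le hs
  obtain ⟨y, hy⟩ := exists_pool_eq_append q R G X s (fresh i :: older q R G X s)
    ⟨[], by rw [pool, hX]; rfl⟩ r
  rw [hy, evolve_fresh_cons q R G X i s r (fun r' hr' => h r' (by omega)) r le_rfl]
  refine le_trans ?_ (topGain_le_append _ _ _)
  simp only [topGain]
  omega

open scoped Classical in
/-- The epoch after the interval of epochs, starting with `s`, in which the older entries cover
expert `i`; if there is none, epoch `s` is left uncovered. -/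
noncomputable def nextStart (i : Fin n) (N s : ℕ) : ℕ :=
  if h : ∃ r, s + r < N ∧ CoveredUpTo q R G X i s r then s + h.choose + 1 else s + 1

/-- The epochs before `coverEnd s` have been dealt with, by covering intervals and single uncovered
epochs, when the intervals starting before `s` are known. -/
noncomputable def coverEnd (i : Fin n) (N : ℕ) : ℕ → ℕ
  | 0 => 0
  | s + 1 => if coverEnd i N s = s then nextStart q R G X i N s else coverEnd i N s

/-- Epoch `s` is uncovered, and expert `i` would not be evicted any more if it joined now. -/
def Trial (i : Fin n) (N : ℕ) (act : ℕ → Prop) (s : ℕ) : Prop :=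
  s < N ∧ act s ∧ coverEnd q R G X i N s = s ∧ ∀ r, s + r < N → ¬ CoveredUpTo q R G X i s r

theorem coveredUpTo_congr {X' : ℕ → Fin n} {s : ℕ} (h : ∀ r < s, X r = X' r) (i : Fin n) :
    CoveredUpTo q R G X i s = CoveredUpTo q R G X' i s := by
  funext r
  simp only [CoveredUpTo]
  rw [older_congr q R G X h]

theorem coverEnd_congr {X' : ℕ → Fin n} {s : ℕ} (h : ∀ r < s, X r = X' r) (i : Fin n) (N : ℕ) :
    coverEnd q R G X i N s = coverEnd q R G X' i N s := by
  induction s with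
  | zero => rfl
  | succ s ih =>
    have h' : ∀ r < s, X r = X' r := fun r hr => h r (by omega)
    have hn : nextStart q R G X i N s = nextStart q R G X' i N s := by
      rw [nextStart, nextStart, coveredUpTo_congr q R G X h' i]
    rw [coverEnd, coverEnd, ih h', hn]

/-- Predictability: only draws before `s` enter, so the draw of epoch `s` is independent of whether
`s` is a trial, provided that the gains `G` do not depend on the draws. -/
theorem trial_congr {X' : ℕ → Fin n} {s : ℕ} (h : ∀ r < s, X r = X' r) (i : Fin n) (N : ℕ)
    (act : ℕ → Prop) : Trial q R G X i N act s ↔ Trial q R G X' i N act s := by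
  simp only [Trial, coverEnd_congr q R G X h, coveredUpTo_congr q R G X h]

theorem le_coverEnd (i : Fin n) (N s : ℕ) : s ≤ coverEnd q R G X i N s := by
  induction s with
  | zero => simp
  | succ s ih =>
    simp only [coverEnd, nextStart]
    split_ifs <;> omega

theorem coverEnd_le (i : Fin n) (N s : ℕ) (hs : s ≤ N) : coverEnd q R G X i N s ≤ N := by
  induction s with
  | zero => simp [coverEnd]
  | succ s ih =>
    have := ih (by omega)
    simp only [coverEnd, nextStart]
    split_ifs with h h'
    · have := h'.choose_spec.1
      omega
    · omega
    · omega

open scoped Classical in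
/-- The number of trials up to which `i` was never chosen. -/
noncomputable def failures (i : Fin n) (N : ℕ) (act : ℕ → Prop) (m : ℕ) : ℕ :=
  #{s ∈ range m | Trial q R G X i N act s ∧ ∀ r ≤ s, Trial q R G X i N act r → X r ≠ i}

/-- In every epoch the pool competes with expert `i`, except for the slack in the eviction rule and
the failed trials. -/
theorem sum_gain_le (i : Fin n) (N : ℕ) (act : ℕ → Prop) (hGR : ∀ s, G s i ≤ R)
    (hact : ∀ s < N, ¬ act s → G s i = 0) :
    q * ∑ τ ∈ range N, G τ i ≤ q * ∑ τ ∈ range N, topGain (fun e => G τ e.expert) (pool q R G X τ) +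
      R * N + q * R * failures q R G X i N act N := by
  classical
  set P : ℕ → ℕ := fun τ => topGain (fun e => G τ e.expert) (pool q R G X τ) with hP
  have claim : ∀ s ≤ N, (∀ r < s, Trial q R G X i N act r → X r ≠ i) →
      q * ∑ τ ∈ range (coverEnd q R G X i N s), G τ i ≤
        q * ∑ τ ∈ range (coverEnd q R G X i N s), P τ + R * coverEnd q R G X i N s +
          q * R * failures q R G X i N act s := by
    intro s
    induction s with
    | zero => simp [coverEnd]
    | succ s ih =>
      intro hs halive
      have ih := ih (by omega) fun r hr => halive r (by omega)
      have hmono : failures q R G X i N act s ≤ failures q R G X i N act (s + 1) := by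
        apply card_le_card
        apply filter_subset_filter
        simp
      by_cases hc : coverEnd q R G X i N s = s
      · rw [hc] at ih
        -- Epoch `s` is uncovered so far. Either an interval starting here is covered, paying `R /
        -- q` per epoch, or the epoch is a failed trial costing at most `R`, or it is inactive and
        -- has gain zero.
        by_cases hcov : ∃ r, s + r < N ∧ CoveredUpTo q R G X i s r
        · have hend : coverEnd q R G X i N (s + 1) = s + (hcov.choose + 1) := by
            simp only [coverEnd, hc, if_true, nextStart, dif_pos hcov]
            omega
          obtain ⟨h1, h2⟩ := hcov.choose_spec
          generalize hcov.choose = r at hend h1 h2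
          rw [hend, sum_range_add _ s (r + 1), sum_range_add _ s (r + 1)]
          have h3 : ∑ τ ∈ range (r + 1), topGain (fun e => G (s + τ) e.expert)
              (evolve q R G s (older q R G X s) τ) ≤ ∑ τ ∈ range (r + 1), P (s + τ) := by
            refine sum_le_sum fun τ _ => ?_
            obtain ⟨y, hy⟩ := exists_pool_eq_append q R G X s (older q R G X s)
              ⟨[fresh (X s)], rfl⟩ τ
            simp only [hP]
            rw [hy]
            exact topGain_le_append _ _ _
          have h4 := Nat.mul_le_mul_left q h3
          have h5 := Nat.mul_le_mul_left (q * R) hmono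
          simp only [CoveredUpTo] at h2
          nlinarith
        · have hend : coverEnd q R G X i N (s + 1) = s + 1 := by
            simp only [coverEnd, hc, if_true, nextStart, dif_neg hcov]
          rw [hend, sum_range_succ, sum_range_succ]
          by_cases ha : act s
          · have hT : Trial q R G X i N act s :=
              ⟨by omega, ha, hc, fun r hr hcr => hcov ⟨r, hr, hcr⟩⟩
            have hf : failures q R G X i N act (s + 1) = failures q R G X i N act s + 1 := by
              simp only [failures, range_add_one, filter_insert]
              rw [if_pos ⟨hT, fun r hr => halive r (by omega)⟩, card_insert_of_notMem (by simp)]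
            rw [hf]
            have := Nat.mul_le_mul_left q (hGR s)
            nlinarith
          · rw [hact s (by omega) ha]
            have h5 := Nat.mul_le_mul_left (q * R) hmono
            nlinarith
      · have hend : coverEnd q R G X i N (s + 1) = coverEnd q R G X i N s := by
          simp only [coverEnd, hc, if_false]
        rw [hend]
        have h5 := Nat.mul_le_mul_left (q * R) hmono
        omega
  -- If some trial draws `i`, the accounting is used up to the first such trial; afterwards `i`
  -- itself is in the pool and nothing is lost.
  by_cases hall : ∀ r < N, Trial q R G X i N act r → X r ≠ i
  · have h1 := claim N le_rfl hall
    have h2 : coverEnd q R G X i N N = N :=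
      le_antisymm (coverEnd_le q R G X i N N le_rfl) (le_coverEnd q R G X i N N)
    rwa [h2] at h1
  · push Not at hall
    obtain ⟨h1, h2, h3⟩ := Nat.find_spec hall
    have hmin := fun r => Nat.find_min (m := r) hall
    generalize Nat.find hall = s at h1 h2 h3 hmin
    have h4 := claim s h1.le fun r hr ht hx => hmin r hr ⟨by omega, ht, hx⟩
    rw [h2.2.2.1] at h4
    have hmono : failures q R G X i N act s ≤ failures q R G X i N act N := by
      apply card_le_card
      apply filter_subset_filter
      simpa using h1.le
    have h5 := Nat.mul_le_mul_left (q * R) hmono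
    obtain ⟨d, rfl⟩ := Nat.exists_eq_add_of_le h1.le
    rw [sum_range_add, sum_range_add]
    have h6 : ∑ τ ∈ range d, G (s + τ) i ≤ ∑ τ ∈ range d, P (s + τ) := by
      refine sum_le_sum fun τ hτ => ?_
      have := mem_range.1 hτ
      exact gain_le_topGain_pool q R G X i s (s + d) h3 h2.2.2.2 (s + τ) (by omega) (by omega)
    have h7 := Nat.mul_le_mul_left q h6
    nlinarith

/-! ### The size of the pool -/

/-- The records of the entries of a pool at the beginning of epoch `s`. -/
def Tracks (s : ℕ) : List (Entry n) → Prop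
  | [] => True
  | e :: l => e.age ≤ s ∧ e.gain = ∑ τ ∈ Ico (s - e.age) s, G τ e.expert ∧
      ∑ τ ∈ Ico (s - e.age) s, topGain (fun e => G τ e.expert) l ≤ e.bench ∧ Tracks s l

variable {G} in
-- The stored benchmark was accumulated against the older entries of the time. Evictions only shrink
-- that set, so it dominates the benchmark computed from those that survive, which is what the size
-- bound needs.
theorem Tracks.closeEpoch {s : ℕ} {l : List (Entry n)} (h : Tracks G s l) :
    Tracks G (s + 1) (closeEpoch q R (fun e => G s e.expert) l) := by
  induction l with
  | nil => trivial
  | cons e l ih =>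
    obtain ⟨h1, h2, h3, h4⟩ := h
    simp only [Pool.closeEpoch]
    split_ifs
    · exact ih h4
    · refine ⟨by simp only [record]; omega, ?_, ?_, ih h4⟩
      · simp only [record, Nat.reduceSubDiff]
        rw [sum_Ico_succ_top (by omega), h2]
      · simp only [record, Nat.reduceSubDiff]
        rw [sum_Ico_succ_top (by omega)]
        refine add_le_add (le_trans (sum_le_sum fun τ _ => ?_) h3) ?_
        · exact topGain_closeEpoch_le q R _ (G τ) l
        · exact topGain_closeEpoch_le q R _ (G s) l

theorem tracks_older (s : ℕ) : Tracks G s (older q R G X s) := by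
  induction s with
  | zero => trivial
  | succ s ih =>
    apply Tracks.closeEpoch
    exact ⟨by simp [fresh], by simp [fresh], by simp [fresh], ih⟩

variable {G} in
-- Induction along the list. The head entry beats its benchmark by more than `R / q` per epoch of
-- its life, so adding it raises the best gain by that much on average. Replacing the weight `1 /
-- age` by `1 / (s - τ)`, which is no smaller on its life and common to all entries, makes the
-- increments telescope.
theorem Tracks.length_mul_le {s : ℕ} {l : List (Entry n)} (h : Tracks G s l)
    (hl : ∀ e ∈ l, ¬ e.Covered q R) :
    (l.length : ℝ) * R ≤
      q * ∑ τ ∈ range s, (topGain (fun e => G τ e.expert) l : ℝ) / ((s - τ : ℕ) : ℝ) := by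
  induction l with
  | nil => simp [topGain]
  | cons e l ih =>
    obtain ⟨h1, h2, h3, h4⟩ := h
    have ih := ih h4 fun e he => hl e (by simp [he])
    have hc := hl e (by simp)
    simp only [Covered, not_le] at hc
    -- At age zero both sides of the eviction test vanish apart from the benchmark, so the entry
    -- would be covered.
    have hage : 0 < e.age := by
      rcases Nat.eq_zero_or_pos e.age with h0 | h0
      · simp [h0] at h2
        simp [h0, h2] at hc
      · exact h0
    have hsub : Ico (s - e.age) s ⊆ range s := by
      intro τ
      simp
    have key : (R : ℝ) ≤ q * ∑ τ ∈ range s,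
        ((topGain (fun e => G τ e.expert) (e :: l) : ℝ) -
          topGain (fun e => G τ e.expert) l) / ((s - τ : ℕ) : ℝ) := by
      have hnn : ∀ τ, (0 : ℝ) ≤ (topGain (fun e => G τ e.expert) (e :: l) : ℝ) -
          topGain (fun e => G τ e.expert) l := by
        intro τ
        rw [sub_nonneg]
        exact_mod_cast topGain_le_append _ [e] l
      have h5 : (∑ τ ∈ Ico (s - e.age) s, ((G τ e.expert : ℝ) -
          topGain (fun e => G τ e.expert) l)) / e.age ≤ ∑ τ ∈ range s,
        ((topGain (fun e => G τ e.expert) (e :: l) : ℝ) -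
          topGain (fun e => G τ e.expert) l) / ((s - τ : ℕ) : ℝ) := by
        rw [sum_div]
        refine le_trans (sum_le_sum fun τ hτ => ?_)
          (sum_le_sum_of_subset_of_nonneg hsub fun τ _ _ => div_nonneg (hnn τ) (by positivity))
        have hτ := mem_Ico.1 hτ
        have hge : (G τ e.expert : ℝ) ≤ topGain (fun e => G τ e.expert) (e :: l) := by
          exact_mod_cast le_topGain (g := fun e => G τ e.expert) (l := e :: l) (by simp)
        calc _ ≤ ((topGain (fun e => G τ e.expert) (e :: l) : ℝ) -
              topGain (fun e => G τ e.expert) l) / e.age := by gcongr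
          _ ≤ _ := by
            apply div_le_div_of_nonneg_left (hnn τ)
            · exact_mod_cast (by omega : 0 < s - τ)
            · exact_mod_cast (by omega : s - τ ≤ e.age)
      have h6 : (q : ℝ) * e.bench + R * e.age ≤ q * e.gain := by exact_mod_cast hc.le
      have h7 : (e.gain : ℝ) = ∑ τ ∈ Ico (s - e.age) s, (G τ e.expert : ℝ) := by
        rw [h2]; push_cast; rfl
      have h8 : ∑ τ ∈ Ico (s - e.age) s, (topGain (fun e => G τ e.expert) l : ℝ) ≤ e.bench := by
        exact_mod_cast h3
      refine le_trans ?_ (mul_le_mul_of_nonneg_left h5 (Nat.cast_nonneg q))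
      rw [← mul_div_assoc, le_div_iff₀ (by exact_mod_cast hage), sum_sub_distrib, ← h7]
      have := mul_le_mul_of_nonneg_left h8 (Nat.cast_nonneg (α := ℝ) q)
      nlinarith
    have hsplit : ∑ τ ∈ range s, (topGain (fun e => G τ e.expert) (e :: l) : ℝ) / ((s - τ : ℕ) : ℝ) =
        ∑ τ ∈ range s, (topGain (fun e => G τ e.expert) l : ℝ) / ((s - τ : ℕ) : ℝ) +
        ∑ τ ∈ range s, ((topGain (fun e => G τ e.expert) (e :: l) : ℝ) -
          topGain (fun e => G τ e.expert) l) / ((s - τ : ℕ) : ℝ) := by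
      rw [← sum_add_distrib]
      refine sum_congr rfl fun τ _ => ?_
      ring
    rw [hsplit, mul_add, List.length_cons]
    push_cast
    linarith

theorem not_covered_of_mem_older {s : ℕ} {e : Entry n} (he : e ∈ older q R G X s) :
    ¬ e.Covered q R := by
  cases s with
  | zero => simp [older] at he
  | succ s => exact (mem_closeEpoch he).1

theorem length_older_le (hR : 0 < R) (hG : ∀ s i, G s i ≤ R) (s N : ℕ) (hs : s ≤ N) :
    ((older q R G X s).length : ℝ) ≤ q * (1 + Real.log N) := by
  have h1 := (tracks_older q R G X s).length_mul_le q R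
    fun e he => not_covered_of_mem_older q R G X he
  have h2 : ∑ τ ∈ range s, (topGain (fun e => G τ e.expert) (older q R G X s) : ℝ) /
      ((s - τ : ℕ) : ℝ) ≤ R * (1 + Real.log N) := by
    calc _ ≤ ∑ τ ∈ range s, (R : ℝ) * (1 / ((s - τ : ℕ) : ℝ)) := by
          refine sum_le_sum fun τ _ => ?_
          rw [mul_one_div]
          gcongr
          exact topGain_le fun e _ => hG τ e.expert
      _ = R * ∑ τ ∈ range s, (1 / ((τ + 1 : ℕ) : ℝ)) := by
          rw [← mul_sum, ← sum_range_reflect]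
          congr 1
          refine sum_congr rfl fun τ hτ => ?_
          have := mem_range.1 hτ
          rw [show s - (s - 1 - τ) = τ + 1 by omega]
      _ ≤ R * ∑ τ ∈ range N, (1 / ((τ + 1 : ℕ) : ℝ)) := by
          gcongr
      _ = R * (harmonic N : ℝ) := by
          simp [harmonic]
      _ ≤ _ := by
          gcongr
          exact harmonic_le_one_add_log N
  have h3 : ((older q R G X s).length : ℝ) * R ≤ (q * (1 + Real.log N)) * R := by
    refine h1.trans ?_
    calc _ ≤ (q : ℝ) * (R * (1 + Real.log N)) := by gcongr
      _ = _ := by ring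
  exact le_of_mul_le_mul_right h3 (by exact_mod_cast hR)

theorem records_older_le (hG : ∀ s i, G s i ≤ R) (s : ℕ) :
    ∀ e ∈ older q R G X s, e.age ≤ s ∧ e.gain ≤ s * R ∧ e.bench ≤ s * R ∧ e.cur = 0 := by
  induction s with
  | zero => simp [older]
  | succ s ih =>
    intro e he
    obtain ⟨-, e₀, h0, b, hb, rfl⟩ := mem_closeEpoch he
    have hb' : b ≤ R := hb.trans (topGain_le fun e _ => hG s e.expert)
    have hg := hG s e₀.expert
    have h1 : e₀.age ≤ s ∧ e₀.gain ≤ s * R ∧ e₀.bench ≤ s * R := by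
      rcases List.mem_cons.1 h0 with rfl | h
      · simp [fresh]
      · have := ih e₀ h
        tauto
    refine ⟨?_, ?_, ?_, rfl⟩ <;> simp only [record] <;> nlinarith [h1.1, h1.2.1, h1.2.2]

end Dynamics

end Pool

/-! ### One level: exponential weights within epochs. -/

namespace Entry

variable {n : ℕ}

/-- Add the loss of a day to the loss in the current epoch. -/
def addLoss (l : Fin n → ℕ) (e : Entry n) : Entry n := { e with cur := e.cur + l e.expert }

theorem record_addLoss (l : Fin n → ℕ) (e : Entry n) (a b : ℕ) :
    (e.addLoss l).record a b = e.record a b := rfl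

theorem addLoss_addLoss (l l' : Fin n → ℕ) (e : Entry n) :
    (e.addLoss l).addLoss l' = e.addLoss (fun i => l i + l' i) := by
  simp [addLoss, add_assoc]

theorem map_addLoss_zero (p : List (Entry n)) : p.map (addLoss fun _ => 0) = p := by
  induction p with
  | nil => rfl
  | cons e p ih => rw [List.map_cons, ih]; simp [addLoss]

end Entry

/-- The state of one level: the loss of the level below in the current epoch, and the pool. -/
@[ext]
structure LevelState (n : ℕ) where
  lower : ℕ
  pool : List (Entry n)

namespace LevelState

open Finset Entry Pool

variable {n : ℕ}

/-! ### Exponential weights on the pool and the level below -/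

/-- The total weight in the exponential weights algorithm with learning rate `η`. -/
noncomputable def norm (η : ℝ) (s : LevelState n) : ℝ :=
  Real.exp (-(η * s.lower)) + (s.pool.map fun e => Real.exp (-(η * e.cur))).sum

/-- The loss of the exponential weights algorithm on a day on which the level below has loss `a`
and expert `i` has loss `l i`. -/
noncomputable def mixedLoss (η : ℝ) (s : LevelState n) (a : ℝ) (l : Fin n → ℝ) : ℝ :=
  (Real.exp (-(η * s.lower)) * a +
    (s.pool.map fun e => Real.exp (-(η * e.cur)) * l e.expert).sum) / s.norm η

/-- The rounded loss of the exponential weights algorithm. -/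
noncomputable def loss (η : ℝ) (s : LevelState n) (a : ℕ) (l : Fin n → ℕ) : ℕ :=
  ⌈s.mixedLoss η a (fun i => l i)⌉₊

/-- Add the losses of a day. -/
def accumulate (a : ℕ) (l : Fin n → ℕ) (s : LevelState n) : LevelState n :=
  ⟨s.lower + a, s.pool.map (addLoss l)⟩

theorem sum_exp_nonneg (η : ℝ) (p : List (Entry n)) :
    0 ≤ (p.map fun e => Real.exp (-(η * e.cur))).sum := by
  apply List.sum_nonneg
  simp only [List.mem_map]
  rintro x ⟨e, -, rfl⟩
  positivity

theorem norm_pos (η : ℝ) (s : LevelState n) : 0 < s.norm η :=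
  add_pos_of_pos_of_nonneg (Real.exp_pos _) (sum_exp_nonneg η s.pool)

theorem mixedLoss_mono (η : ℝ) (s : LevelState n) {a b : ℝ} (hab : a ≤ b) (l : Fin n → ℝ) :
    s.mixedLoss η a l ≤ s.mixedLoss η b l := by
  unfold mixedLoss
  gcongr
  exact (norm_pos η s).le

theorem mixedLoss_le (η : ℝ) (s : LevelState n) {a Q : ℝ} {l : Fin n → ℝ} (ha : a ≤ Q)
    (hl : ∀ i, l i ≤ Q) : s.mixedLoss η a l ≤ Q := by
  rw [mixedLoss, div_le_iff₀ (norm_pos η s), norm, mul_add, ← List.sum_map_mul_left]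
  refine add_le_add ?_ ?_
  · rw [mul_comm]
    gcongr
  · apply List.sum_le_sum
    intro e _
    rw [mul_comm]
    gcongr
    exact hl _

theorem loss_le (η : ℝ) (s : LevelState n) {a Q : ℕ} {l : Fin n → ℕ} (ha : a ≤ Q)
    (hl : ∀ i, l i ≤ Q) : s.loss η a l ≤ Q := by
  apply Nat.ceil_le.2
  apply mixedLoss_le
  · exact_mod_cast ha
  · intro i
    exact_mod_cast hl i

theorem mixedLoss_nonneg (η : ℝ) (s : LevelState n) {a : ℝ} {l : Fin n → ℝ} (ha : 0 ≤ a)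
    (hl : ∀ i, 0 ≤ l i) : 0 ≤ s.mixedLoss η a l := by
  apply div_nonneg _ (norm_pos η s).le
  apply add_nonneg (by positivity)
  apply List.sum_nonneg
  simp only [List.mem_map]
  rintro x ⟨e, -, rfl⟩
  exact mul_nonneg (by positivity) (hl _)

/-- The potential step of exponential weights, from `exp (-x) ≤ 1 - x + x ^ 2` on `[0, 1]`. -/
theorem norm_accumulate_le {η : ℝ} {Q : ℕ} (hη : 0 ≤ η) (hηQ : η * Q ≤ 1) (s : LevelState n)
    {a : ℕ} {l : Fin n → ℕ} (ha : a ≤ Q) (hl : ∀ i, l i ≤ Q) :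
    (s.accumulate a l).norm η ≤
      s.norm η * Real.exp (-(η * s.mixedLoss η a (fun i => l i)) + (η * Q) ^ 2) := by
  have hexp : ∀ x : ℕ, x ≤ Q → Real.exp (-(η * x)) ≤ 1 - η * x + (η * Q) ^ 2 := by
    intro x hx
    have hxQ : η * x ≤ η * Q := by
      have : (x : ℝ) ≤ Q := by exact_mod_cast hx
      gcongr
    have h0 : 0 ≤ η * x := by positivity
    have h1 : |-(η * x)| ≤ 1 := by
      rw [abs_neg, abs_of_nonneg h0]
      linarith
    have := (abs_le.1 (Real.abs_exp_sub_one_sub_id_le h1)).2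
    nlinarith
  have hsplit : ∀ c x : ℕ, x ≤ Q → Real.exp (-(η * ((c + x : ℕ) : ℝ))) ≤
      Real.exp (-(η * c)) * (1 + (η * Q) ^ 2) - η * (Real.exp (-(η * c)) * x) := by
    intro c x hx
    have : -(η * ((c + x : ℕ) : ℝ)) = -(η * c) + -(η * x) := by push_cast; ring
    rw [this, Real.exp_add]
    have := mul_le_mul_of_nonneg_left (hexp x hx) (Real.exp_pos (-(η * c))).le
    linarith
  have hsum : ∀ p : List (Entry n),
      ((p.map (addLoss l)).map fun e => Real.exp (-(η * e.cur))).sum ≤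
      (p.map fun e => Real.exp (-(η * e.cur))).sum * (1 + (η * Q) ^ 2) -
        η * (p.map fun e => Real.exp (-(η * e.cur)) * (l e.expert : ℝ)).sum := by
    intro p
    induction p with
    | nil => simp
    | cons e p ih =>
      simp only [List.map_cons, List.sum_cons]
      have := hsplit e.cur (l e.expert) (hl _)
      simp only [addLoss] at ih ⊢
      linarith
  have hZ := norm_pos η s
  have hmix : s.mixedLoss η a (fun i => l i) * s.norm η = Real.exp (-(η * s.lower)) * a +
      (s.pool.map fun e => Real.exp (-(η * e.cur)) * (l e.expert : ℝ)).sum := by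
    rw [mixedLoss, div_mul_cancel₀ _ hZ.ne']
  calc (s.accumulate a l).norm η
      ≤ s.norm η * (1 + (η * Q) ^ 2) - η * (s.mixedLoss η a (fun i => l i) * s.norm η) := by
        rw [hmix, norm, norm, accumulate]
        have := hsum s.pool
        have := hsplit s.lower a ha
        linarith
    _ = s.norm η * ((-(η * s.mixedLoss η a (fun i => l i)) + (η * Q) ^ 2) + 1) := by ring
    _ ≤ _ := by
        gcongr
        exact Real.add_one_le_exp _

/-- The state after `r` days of an epoch that starts on day `d` with pool `p`. -/
def during (a : ℕ → ℕ) (l : ℕ → Fin n → ℕ) (d : ℕ) (p : List (Entry n)) (r : ℕ) : LevelState n :=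
  ⟨∑ k ∈ range r, a (d + k), p.map (addLoss fun i => ∑ k ∈ range r, l (d + k) i)⟩

theorem accumulate_during (a : ℕ → ℕ) (l : ℕ → Fin n → ℕ) (d : ℕ) (p : List (Entry n)) (r : ℕ) :
    (during a l d p r).accumulate (a (d + r)) (l (d + r)) = during a l d p (r + 1) := by
  simp only [during, accumulate, sum_range_succ, List.map_map]
  congr 1
  refine List.map_congr_left fun e _ => ?_
  exact addLoss_addLoss _ _ e

/-- The regret of exponential weights in an epoch of `E` days. -/
theorem sum_loss_during_le {η : ℝ} {Q E : ℕ} (hη : 0 < η) (hηQ : η * Q ≤ 1) {a : ℕ → ℕ}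
    {l : ℕ → Fin n → ℕ} (ha : ∀ t, a t ≤ Q) (hl : ∀ t i, l t i ≤ Q) (d : ℕ) (p : List (Entry n))
    (hp : ∀ e ∈ p, e.cur = 0) (c : ℕ)
    (hc : c = ∑ k ∈ range E, a (d + k) ∨ ∃ e ∈ p, c = ∑ k ∈ range E, l (d + k) e.expert) :
    (∑ k ∈ range E, (during a l d p k).loss η (a (d + k)) (l (d + k)) : ℝ) ≤
      c + Real.log (p.length + 1) / η + E * (η * Q ^ 2 + 1) := by
  have hstep : ∀ r, η * (∑ k ∈ range r, (during a l d p k).loss η (a (d + k)) (l (d + k)) : ℝ) ≤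
      Real.log ((during a l d p 0).norm η) - Real.log ((during a l d p r).norm η) +
        r * ((η * Q) ^ 2 + η) := by
    intro r
    induction r with
    | zero => simp
    | succ r ih =>
      have h1 := norm_accumulate_le hη.le hηQ (during a l d p r) (ha (d + r)) (hl (d + r))
      rw [accumulate_during] at h1
      have h2 := Real.log_le_log (norm_pos η _) h1
      rw [Real.log_mul (norm_pos η _).ne' (Real.exp_pos _).ne', Real.log_exp] at h2
      have h3 : ((during a l d p r).loss η (a (d + r)) (l (d + r)) : ℝ) ≤
          -- Rounding the loss up costs one unit a day, the summand `1` in the final bound.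
          (during a l d p r).mixedLoss η (a (d + r)) (fun i => l (d + r) i) + 1 :=
        (Nat.ceil_lt_add_one (mixedLoss_nonneg η _ (by positivity) fun i => by positivity)).le
      have h4 := mul_le_mul_of_nonneg_left h3 hη.le
      rw [sum_range_succ, mul_add]
      push_cast
      linarith
  have h0 : (during a l d p 0).norm η = p.length + 1 := by
    have : (during a l d p 0).pool = p := by
      simp [during, map_addLoss_zero]
    rw [norm, this]
    have h2 : p.map (fun e => Real.exp (-(η * e.cur))) = p.map (fun _ => (1 : ℝ)) := by
      refine List.map_congr_left fun e he => ?_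
      simp [hp e he]
    rw [h2]
    simp [during, add_comm]
  -- The comparator `c` contributes one term to the final norm: either the level below or one entry
  -- of the pool.
  have hend : Real.exp (-(η * c)) ≤ (during a l d p E).norm η := by
    rcases hc with rfl | ⟨e, he, rfl⟩
    · rw [norm]
      have := sum_exp_nonneg η (during a l d p E).pool
      simp only [during] at this ⊢
      linarith
    · rw [norm]
      have h1 : Real.exp (-(η * ((∑ k ∈ range E, l (d + k) e.expert : ℕ) : ℝ))) ≤
          ((during a l d p E).pool.map fun e => Real.exp (-(η * e.cur))).sum := by
        apply List.single_le_sum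
        · simp only [List.mem_map]
          rintro x ⟨e, -, rfl⟩
          positivity
        · simp only [during, List.map_map, List.mem_map]
          refine ⟨e, he, ?_⟩
          simp [addLoss, hp e he]
      have := Real.exp_pos (-(η * (during a l d p E).lower))
      linarith
  have h1 := hstep E
  have h2 := Real.log_le_log (Real.exp_pos _) hend
  rw [Real.log_exp] at h2
  rw [h0] at h1
  have h3 : η * (∑ k ∈ range E, (during a l d p k).loss η (a (d + k)) (l (d + k)) : ℝ) ≤
      η * (c + Real.log (p.length + 1) / η + E * (η * Q ^ 2 + 1)) := by
    rw [mul_add, mul_add, mul_div_cancel₀ _ hη.ne']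
    nlinarith
  exact le_of_mul_le_mul_left h3 hη

/-! ### The run of a level -/

/-- The gain of an entry, at the end of an epoch, over the level below; it is cut off at `R`. -/
def entryGain (R : ℕ) (s : LevelState n) (e : Entry n) : ℕ := min R (s.lower - e.cur)

/-- The state at the beginning of day `t + 1`, when expert `x` joins the pool if a new epoch
begins.  An epoch has `E` days, and after `N` epochs the level starts afresh. -/
def step (q R E N t a : ℕ) (l : Fin n → ℕ) (x : Fin n) (s : LevelState n) : LevelState n :=
  if E ∣ t + 1 then
    ⟨0, fresh x :: if E * N ∣ t + 1 then [] else
      closeEpoch q R (entryGain R (s.accumulate a l)) (s.accumulate a l).pool⟩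
  else s.accumulate a l

/-- The state at the beginning of day `t`, when the level below has loss `a t` and expert `i`
has loss `l t i` on day `t`, and expert `X t` joins on day `t` if an epoch begins on this day. -/
def run (q R E N : ℕ) (a : ℕ → ℕ) (l : ℕ → Fin n → ℕ) (X : ℕ → Fin n) : ℕ → LevelState n
  | 0 => ⟨0, [fresh (X 0)]⟩
  | t + 1 => step q R E N t (a t) (l t) (X (t + 1)) (run q R E N a l X t)

section Run

variable (q R E N : ℕ) (a : ℕ → ℕ) (l : ℕ → Fin n → ℕ) (X : ℕ → Fin n)

theorem run_add {d : ℕ} (hd : E ∣ d) {p : List (Entry n)}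
    (h : run q R E N a l X d = ⟨0, p⟩) (r : ℕ) (hr : r < E) :
    run q R E N a l X (d + r) = during a l d p r := by
  induction r with
  | zero => simpa [during, map_addLoss_zero] using h
  | succ r ih =>
    rw [← add_assoc, run, step, if_neg, ih (by omega), accumulate_during]
    rw [add_assoc, Nat.dvd_add_right hd]
    exact Nat.not_dvd_of_pos_of_lt (by omega) hr

/-- The gains of the experts in epoch `s` of the instance that starts on day `d`. -/
def epochGain (d s : ℕ) (i : Fin n) : ℕ :=
  min R (∑ k ∈ range E, a (d + s * E + k) - ∑ k ∈ range E, l (d + s * E + k) i)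

theorem run_add_epoch (hE : 0 < E) {d s : ℕ} (hd : E ∣ d) {p : List (Entry n)}
    (hp : ∀ e ∈ p, e.cur = 0) (h : run q R E N a l X (d + s * E) = ⟨0, p⟩) :
    run q R E N a l X (d + (s + 1) * E) = ⟨0, fresh (X (d + (s + 1) * E)) ::
      if E * N ∣ d + (s + 1) * E then [] else
        closeEpoch q R (fun e => epochGain R E a l d s e.expert) p⟩ := by
  have hdvd : E ∣ d + s * E := dvd_add hd (dvd_mul_left E s)
  obtain ⟨r, rfl⟩ : ∃ r, E = r + 1 := ⟨E - 1, by omega⟩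
  have h1 := run_add q R (r + 1) N a l X hdvd h r (by omega)
  have h2 : d + (s + 1) * (r + 1) = d + s * (r + 1) + r + 1 := by ring
  have hdvd' : (r + 1) ∣ d + s * (r + 1) + r + 1 := by
    rw [add_assoc]
    exact dvd_add hdvd (dvd_refl _)
  rw [h2, run, step, if_pos hdvd', h1, accumulate_during]
  congr 3
  simp only [during]
  rw [closeEpoch_map _ _ _ _ (fun e a b => record_addLoss _ e a b)]
  apply closeEpoch_congr
  intro e he
  simp [entryGain, epochGain, addLoss, hp e he]

theorem cur_eq_zero_of_mem_pool {G : ℕ → Fin n → ℕ} {X : ℕ → Fin n} {s : ℕ} {e : Entry n}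
    (he : e ∈ Pool.pool q R G X s) : e.cur = 0 := by
  rcases List.mem_cons.1 he with rfl | h
  · rfl
  · cases s with
    | zero => simp [older] at h
    | succ s =>
      obtain ⟨-, e₀, -, b, -, rfl⟩ := mem_closeEpoch h
      rfl

/-- Identifies the daily recursion with the abstract pool dynamics, fed with the epoch gains and the
draws at the first days of epochs; each instance starts from an empty older part. -/
theorem run_instance (hE : 0 < E) (hN : 0 < N) (I : ℕ) (s : ℕ) (hs : s < N) :
    run q R E N a l X (I * (E * N) + s * E) =
      ⟨0, Pool.pool q R (epochGain R E a l (I * (E * N)))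
        (fun s => X (I * (E * N) + s * E)) s⟩ := by
  have hdvd : ∀ I, E ∣ I * (E * N) := fun I => ⟨I * N, by ring⟩
  have main : ∀ I, run q R E N a l X (I * (E * N)) = ⟨0, [fresh (X (I * (E * N)))]⟩ →
      ∀ s < N, run q R E N a l X (I * (E * N) + s * E) =
        ⟨0, Pool.pool q R (epochGain R E a l (I * (E * N)))
        (fun s => X (I * (E * N) + s * E)) s⟩ := by
    intro I hI s
    induction s with
    | zero => intro _; simpa [Pool.pool, older] using hI
    | succ s ih =>
      intro hs
      rw [run_add_epoch q R E N a l X hE (hdvd I)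
        (fun e he => cur_eq_zero_of_mem_pool q R he) (ih (by omega)), if_neg]
      · rfl
      · rw [Nat.dvd_add_right (dvd_mul_left _ _), mul_comm E N]
        intro h
        have := Nat.le_of_dvd (by positivity) h
        have := Nat.le_of_mul_le_mul_right this hE
        omega
  have start : ∀ I, run q R E N a l X (I * (E * N)) = ⟨0, [fresh (X (I * (E * N)))]⟩ := by
    intro I
    induction I with
    | zero => simp [run]
    | succ I ih =>
      obtain ⟨m, rfl⟩ : ∃ m, N = m + 1 := ⟨N - 1, by omega⟩
      have h1 := run_add_epoch q R E (m + 1) a l X hE (hdvd I)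
        (fun e he => cur_eq_zero_of_mem_pool q R he) (main I ih m (by omega))
      have h2 : I * (E * (m + 1)) + (m + 1) * E = (I + 1) * (E * (m + 1)) := by ring
      rw [h2, if_pos (dvd_mul_left _ _)] at h1
      exact h1
  exact main I (start I) s hs

theorem run_instance_day (hE : 0 < E) (hN : 0 < N) (I s r : ℕ) (hs : s < N) (hr : r < E) :
    run q R E N a l X (I * (E * N) + s * E + r) =
      during a l (I * (E * N) + s * E) (Pool.pool q R (epochGain R E a l (I * (E * N)))
        (fun s => X (I * (E * N) + s * E)) s) r :=
  run_add q R E N a l X (dvd_add ⟨I * N, by ring⟩ (dvd_mul_left E s))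
    (run_instance q R E N a l X hE hN I s hs) r hr

theorem sum_range_mul_eq (f : ℕ → ℝ) (d : ℕ) :
    ∑ k ∈ range (E * N), f (d + k) = ∑ s ∈ range N, ∑ k ∈ range E, f (d + s * E + k) := by
  induction N with
  | zero => simp
  | succ N ih =>
    rw [mul_add, mul_one, sum_range_add, sum_range_succ, ih]
    congr 1
    refine sum_congr rfl fun k _ => ?_
    congr 1
    ring

/-- The regret of a level over one instance, relative to expert `i`, when the regret of the level
below is at most `R` in every epoch. -/
theorem sum_loss_run_le {η : ℝ} {Q : ℕ} (hη : 0 < η) (hηQ : η * Q ≤ 1) (hE : 0 < E) (hN : 0 < N)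
    (hq : 0 < q) (hR : 0 < R) (ha : ∀ t, a t ≤ Q) (hl : ∀ t i, l t i ≤ Q) (I : ℕ) (i : Fin n)
    (act : ℕ → Prop)
    (hact : ∀ s < N, ¬ act s → ∀ k < E, a (I * (E * N) + s * E + k) = 0)
    (hlow : ∀ s < N, ∑ k ∈ range E, a (I * (E * N) + s * E + k) ≤
      ∑ k ∈ range E, l (I * (E * N) + s * E + k) i + R) :
    (∑ k ∈ range (E * N), ((run q R E N a l X (I * (E * N) + k)).loss η
        (a (I * (E * N) + k)) (l (I * (E * N) + k)) : ℝ)) ≤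
      ∑ k ∈ range (E * N), (l (I * (E * N) + k) i : ℝ) + R * N / q +
      R * failures q R (epochGain R E a l (I * (E * N))) (fun s => X (I * (E * N) + s * E))
        i N act N +
      N * (Real.log (q * (1 + Real.log N) + 2) / η + E * (η * Q ^ 2 + 1)) := by
  set d := I * (E * N) with hd
  set G := epochGain R E a l d with hG
  set X' : ℕ → Fin n := fun s => X (d + s * E) with hX'
  have hGR : ∀ s j, G s j ≤ R := fun s j => min_le_left _ _
  set c : ℝ := Real.log (q * (1 + Real.log N) + 2) / η + E * (η * Q ^ 2 + 1) with hc
  have hepoch : ∀ s < N, ∑ k ∈ range E, ((run q R E N a l X (d + s * E + k)).loss η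
        (a (d + s * E + k)) (l (d + s * E + k)) : ℝ) ≤
      ∑ k ∈ range E, (l (d + s * E + k) i : ℝ) + G s i -
        topGain (fun e => G s e.expert) (Pool.pool q R G X' s) + c := by
    intro s hs
    have h1 : ∑ k ∈ range E, ((run q R E N a l X (d + s * E + k)).loss η
        (a (d + s * E + k)) (l (d + s * E + k)) : ℝ) =
        ∑ k ∈ range E, ((during a l (d + s * E) (Pool.pool q R G X' s) k).loss η
        (a (d + s * E + k)) (l (d + s * E + k)) : ℝ) := by
      refine sum_congr rfl fun k hk => ?_
      rw [run_instance_day q R E N a l X hE hN I s k hs (mem_range.1 hk)]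
    have h2 := fun c => sum_loss_during_le hη hηQ ha hl (d + s * E) (E := E) (Pool.pool q R G X' s)
      (fun e he => cur_eq_zero_of_mem_pool q R he) c
    have hlen : Real.log ((Pool.pool q R G X' s).length + 1) / η + E * (η * Q ^ 2 + 1) ≤ c := by
      have h3 := length_older_le q R G X' hR hGR s N hs.le
      have h4 : ((Pool.pool q R G X' s).length : ℝ) = (older q R G X' s).length + 1 := by
        simp [Pool.pool]
      have h5 := Real.log_le_log (by positivity)
        (by linarith : ((Pool.pool q R G X' s).length : ℝ) + 1 ≤ q * (1 + Real.log N) + 2)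
      exact add_le_add (div_le_div_of_nonneg_right h5 hη.le) le_rfl
    rw [h1]
    -- Since the level below has regret at most `R` against `i`, cutting the gain off at `R` loses
    -- nothing for this expert.
    have hA : (∑ k ∈ range E, a (d + s * E + k) : ℝ) ≤
        ∑ k ∈ range E, (l (d + s * E + k) i : ℝ) + G s i := by
      have h5 := hlow s hs
      have h6 : ∑ k ∈ range E, a (d + s * E + k) ≤
          ∑ k ∈ range E, l (d + s * E + k) i + G s i := by
        simp only [hG, epochGain]
        omega
      exact_mod_cast h6
    -- Exponential weights are compared with the level below when the best gain is zero, otherwise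
    -- with an entry that attains it.
    rcases topGain_eq_zero_or_mem (fun e => G s e.expert) (Pool.pool q R G X' s) with h0 | ⟨e, he, h0⟩
    · have h3 := h2 _ (Or.inl rfl)
      push_cast at h3
      rw [h0]
      push_cast
      linarith
    · rw [h0]
      by_cases hz : G s e.expert = 0
      · have h3 := h2 _ (Or.inl rfl)
        push_cast at h3
        rw [hz]
        push_cast
        linarith
      · have h3 := h2 _ (Or.inr ⟨e, he, rfl⟩)
        have h4 : ∑ k ∈ range E, l (d + s * E + k) e.expert + G s e.expert ≤
            ∑ k ∈ range E, a (d + s * E + k) := by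
          simp only [hG, epochGain] at hz ⊢
          omega
        have h5 : (∑ k ∈ range E, l (d + s * E + k) e.expert + G s e.expert : ℝ) ≤
            ∑ k ∈ range E, (a (d + s * E + k) : ℝ) := by exact_mod_cast h4
        push_cast at h3 h5
        linarith
  have hgain := sum_gain_le q R G X' i N act (fun s => hGR s i) (by
    intro s hs hna
    have h0 : ∑ k ∈ range E, a (d + s * E + k) = 0 :=
      sum_eq_zero fun k hk => hact s hs hna k (mem_range.1 hk)
    simp only [hG, epochGain, h0]
    simp)
  have hgain' : (∑ τ ∈ range N, (G τ i : ℝ)) ≤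
      ∑ τ ∈ range N, (topGain (fun e => G τ e.expert) (Pool.pool q R G X' τ) : ℝ) + R * N / q +
        R * failures q R G X' i N act N := by
    have hq' : (0 : ℝ) < q := by exact_mod_cast hq
    have h7 : (q : ℝ) * (∑ τ ∈ range N, (G τ i : ℝ)) ≤
      q * ∑ τ ∈ range N, (topGain (fun e => G τ e.expert) (Pool.pool q R G X' τ) : ℝ) + R * N +
        q * R * failures q R G X' i N act N := by exact_mod_cast hgain
    refine le_of_mul_le_mul_left (h7.trans (le_of_eq ?_)) hq'
    field_simp
  rw [sum_range_mul_eq E N (fun t => ((run q R E N a l X t).loss η (a t) (l t) : ℝ)) d,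
    sum_range_mul_eq E N (fun t => (l t i : ℝ)) d]
  refine (sum_le_sum fun s hs => hepoch s (mem_range.1 hs)).trans ?_
  rw [sum_add_distrib, sum_sub_distrib, sum_add_distrib]
  simp only [sum_const, card_range, nsmul_eq_mul]
  linarith

end Run

end LevelState

/-! ### The hierarchy of levels and its regret recursion. -/

/-- The number of experts and days, and the inverse `q` of the slack in the eviction rule. -/
structure Params where
  n : ℕ
  T : ℕ
  q : ℕ
  n_pos : 0 < n
  T_pos : 0 < T
  q_pos : 0 < q
  q_le : q ≤ n

namespace Params

open Finset LevelState Pool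

variable (P : Params)

instance : NeZero P.n := ⟨P.n_pos.ne'⟩

/-- The length of a word. -/
def L : ℕ := Nat.log 2 (P.n * P.T) + 1

/-- The number of epochs in an instance of a level. -/
def N : ℕ := P.n * P.q

/-- The number of levels. -/
def k : ℕ := Nat.log P.N P.T

/-- The length of an epoch of level `j`. -/
def E (j : ℕ) : ℕ := P.N ^ (j + 1)

/-- The bound for the regret in an epoch of level `j`; losses are measured in units of `1 / T`. -/
def R (j : ℕ) : ℕ := P.N * P.T * (P.n * (10 * P.L ^ 2)) ^ j

/-- The learning rate of level `j`. -/
noncomputable def η (j : ℕ) : ℝ := 1 / (P.T * P.n ^ (j + 1))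

/-- The loss of level `j` (counted from the bottom) on day `t`, when `X j t` is the expert drawn by
level `j` on day `t`. -/
noncomputable def levelLoss (l : ℕ → Fin P.n → ℕ) (X : ℕ → ℕ → Fin P.n) : ℕ → ℕ → ℕ
  | 0, t => l t 0
  | j + 1, t => (run P.q (P.R j) (P.E j) P.N (levelLoss l X j) l (X j) t).loss (P.η j)
      (levelLoss l X j t) (l t)

/-- The state of level `j` at the beginning of day `t`. -/
noncomputable def levelState (l : ℕ → Fin P.n → ℕ) (X : ℕ → ℕ → Fin P.n) (j : ℕ) :
    ℕ → LevelState P.n :=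
  run P.q (P.R j) (P.E j) P.N (P.levelLoss l X j) l (X j)

theorem N_pos : 0 < P.N := Nat.mul_pos P.n_pos P.q_pos

theorem E_pos (j : ℕ) : 0 < P.E j := pow_pos P.N_pos _

theorem L_pos : 0 < P.L := Nat.succ_pos _

theorem R_pos (j : ℕ) : 0 < P.R j := by
  have := P.N_pos
  have := P.T_pos
  have := P.n_pos
  have := P.L_pos
  unfold R
  positivity

theorem η_pos (j : ℕ) : 0 < P.η j := by
  have := P.T_pos
  have := P.n_pos
  unfold η
  positivity

theorem N_le : P.N ≤ P.n ^ 2 := by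
  rw [N, sq]
  exact Nat.mul_le_mul_left _ P.q_le

theorem mul_lt_two_pow_L : P.n * P.T < 2 ^ P.L := Nat.lt_pow_succ_log_self (by norm_num) _

theorem n_lt : P.n < 2 ^ P.L :=
  lt_of_le_of_lt (Nat.le_mul_of_pos_right _ P.T_pos) P.mul_lt_two_pow_L

theorem T_lt : P.T < 2 ^ P.L :=
  lt_of_le_of_lt (Nat.le_mul_of_pos_left _ P.n_pos) P.mul_lt_two_pow_L

theorem log_le_of_lt {x : ℕ} (hx : 0 < x) {m : ℕ} (h : x < 2 ^ m) : Real.log x ≤ m := by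
  have h1 : Real.log x ≤ Real.log (2 ^ m) :=
    Real.log_le_log (by exact_mod_cast hx) (by exact_mod_cast h.le)
  rw [Real.log_pow] at h1
  have h2 := Real.log_two_lt_d9
  have h3 : (0 : ℝ) ≤ m := by positivity
  nlinarith

theorem log_N_le : Real.log P.N ≤ 2 * P.L := by
  have h : P.N < 2 ^ (2 * P.L) := by
    refine lt_of_le_of_lt P.N_le ?_
    rw [mul_comm, pow_mul]
    exact Nat.pow_lt_pow_left P.n_lt (by norm_num)
  exact_mod_cast log_le_of_lt P.N_pos h

theorem E_le_T {j : ℕ} (hj : j < P.k) : P.E j ≤ P.T :=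
  (Nat.pow_le_pow_right P.N_pos hj).trans (Nat.pow_log_le_self _ P.T_pos.ne')

theorem levelLoss_le {l : ℕ → Fin P.n → ℕ} {Q : ℕ} (hl : ∀ t i, l t i ≤ Q)
    (X : ℕ → ℕ → Fin P.n) (j t : ℕ) : P.levelLoss l X j t ≤ Q := by
  induction j generalizing t with
  | zero => exact hl _ _
  | succ j ih => exact loss_le _ _ (ih t) (hl t)

theorem levelLoss_eq_zero {l : ℕ → Fin P.n → ℕ} {t : ℕ} (hl : ∀ i, l t i = 0)
    (X : ℕ → ℕ → Fin P.n) (j : ℕ) : P.levelLoss l X j t = 0 := by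
  induction j with
  | zero => exact hl _
  | succ j ih =>
    rw [levelLoss, ih]
    exact Nat.le_zero.1 (loss_le _ _ le_rfl fun i => (hl i).le)

/-- The gains at level `j` are measured against losses that only draws at levels below `j`
influence. Hence they stay fixed when a draw of level `j` is resampled. -/
theorem levelLoss_congr {l : ℕ → Fin P.n → ℕ} {X X' : ℕ → ℕ → Fin P.n} {j : ℕ}
    (h : ∀ r < j, X r = X' r) : P.levelLoss l X j = P.levelLoss l X' j := by
  induction j with
  | zero => rfl
  | succ j ih =>
    funext t
    rw [levelLoss, levelLoss, ih fun r hr => h r (by omega), h j (by omega)]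

/-- The first day of the instance with number `I` of level `j`. -/
def start (j I : ℕ) : ℕ := I * (P.E j * P.N)

/-- The epochs that begin before day `T`. -/
def Active (j I s : ℕ) : Prop := P.start j I + s * P.E j < P.T

/-- The trials of an instance of level `j` at which expert `i` is not drawn. -/
noncomputable def instanceFailures (l : ℕ → Fin P.n → ℕ) (X : ℕ → ℕ → Fin P.n) (i : Fin P.n)
    (j I : ℕ) : ℕ :=
  failures P.q (P.R j) (epochGain (P.R j) (P.E j) (P.levelLoss l X j) l (P.start j I))
    (fun s => X j (P.start j I + s * P.E j)) i P.N (P.Active j I) P.N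

theorem log_options_le : Real.log (P.q * (1 + Real.log P.N) + 2) ≤ 3 * P.L + 2 := by
  have hn : (1 : ℝ) ≤ P.n := by exact_mod_cast P.n_pos
  have hq : (P.q : ℝ) ≤ P.n := by exact_mod_cast P.q_le
  have hL : (1 : ℝ) ≤ P.L := by exact_mod_cast P.L_pos
  have h0 : 0 ≤ Real.log P.N := Real.log_natCast_nonneg _
  have h1 : (P.q : ℝ) * (1 + Real.log P.N) + 2 ≤ P.n * (2 * P.L + 3) := by
    calc (P.q : ℝ) * (1 + Real.log P.N) + 2 ≤ P.n * (1 + 2 * P.L) + 2 := by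
          gcongr
          exact P.log_N_le
      _ ≤ _ := by nlinarith
  calc _ ≤ Real.log (P.n * (2 * P.L + 3)) := Real.log_le_log (by positivity) h1
    _ = Real.log P.n + Real.log (2 * P.L + 3) := Real.log_mul (by positivity) (by positivity)
    _ ≤ P.L + (2 * P.L + 3 - 1) :=
        add_le_add (log_le_of_lt P.n_pos P.n_lt) (Real.log_le_sub_one_of_pos (by positivity))
    _ = _ := by ring

/-- With `N / q = n`, the slack costs `R j * n`, the failed trials `2 L²` times that, and
exponential weights at most `3 L + 4` times that; the total is at most `10 L²` times `R j * n`. The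
learning rate `1 / (T n^(j+1))` makes both `1 / η` and `E η T²` of order at most `T n^(j+1)`,
because `E j ≤ n^(2(j+1))`. -/
theorem regret_step {j : ℕ} (hj : j < P.k) :
    (P.R j : ℝ) * P.N / P.q + P.R j * (2 * P.n * P.L ^ 2) +
      P.N * (Real.log (P.q * (1 + Real.log P.N) + 2) / P.η j +
        P.E j * (P.η j * P.T ^ 2 + 1)) ≤ P.R (j + 1) := by
  have hn : (0 : ℝ) < P.n := by exact_mod_cast P.n_pos
  have hn1 : (1 : ℝ) ≤ P.n := by exact_mod_cast P.n_pos
  have hq : (0 : ℝ) < P.q := by exact_mod_cast P.q_pos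
  have hT : (0 : ℝ) < P.T := by exact_mod_cast P.T_pos
  have hL : (1 : ℝ) ≤ P.L := by exact_mod_cast P.L_pos
  have hN : (0 : ℝ) < P.N := by exact_mod_cast P.N_pos
  have hpow : (1 : ℝ) ≤ P.n ^ (j + 1) := one_le_pow₀ hn1
  have h1 : (P.R j : ℝ) * P.N / P.q = P.R j * P.n := by
    rw [N]
    push_cast
    field_simp
  have h2 : Real.log (P.q * (1 + Real.log P.N) + 2) / P.η j ≤
      (3 * P.L + 2) * (P.T * P.n ^ (j + 1)) := by
    rw [η, div_div_eq_mul_div, div_one]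
    gcongr
    exact P.log_options_le
  have h3 : (P.E j : ℝ) * (P.η j * P.T ^ 2 + 1) ≤ 2 * (P.T * P.n ^ (j + 1)) := by
    have ha : (P.E j : ℝ) ≤ P.n ^ (j + 1) * P.n ^ (j + 1) := by
      rw [← mul_pow, ← sq]
      exact_mod_cast Nat.pow_le_pow_left P.N_le (j + 1)
    have hb : (P.E j : ℝ) ≤ P.T := by exact_mod_cast P.E_le_T hj
    have hc : (P.E j : ℝ) * (P.η j * P.T ^ 2) ≤ P.T * P.n ^ (j + 1) := by
      have : (P.E j : ℝ) * (P.η j * P.T ^ 2) = P.E j * P.T / P.n ^ (j + 1) := by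
        rw [η]
        field_simp
      rw [this, div_le_iff₀ (by positivity)]
      nlinarith
    have hd : (P.T : ℝ) ≤ P.T * P.n ^ (j + 1) := le_mul_of_one_le_right hT.le hpow
    linarith
  have h4 : (P.N : ℝ) * (P.T * P.n ^ (j + 1)) ≤ P.R j * P.n := by
    rw [R]
    push_cast
    have h5 : (P.n : ℝ) ^ j ≤ (P.n * (10 * P.L ^ 2)) ^ j := by
      gcongr
      exact le_mul_of_one_le_right hn.le (by nlinarith)
    calc (P.N : ℝ) * (P.T * P.n ^ (j + 1)) = P.N * P.T * P.n ^ j * P.n := by ring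
      _ ≤ _ := by gcongr
  have h6 : (P.R (j + 1) : ℝ) = P.R j * P.n * (10 * P.L ^ 2) := by
    simp only [R]
    push_cast
    ring
  rw [h1, h6]
  have h7 : (P.N : ℝ) * (Real.log (P.q * (1 + Real.log P.N) + 2) / P.η j +
        P.E j * (P.η j * P.T ^ 2 + 1)) ≤ (3 * P.L + 4) * (P.R j * P.n) := by
    calc _ ≤ (P.N : ℝ) * ((3 * P.L + 2) * (P.T * P.n ^ (j + 1)) +
          2 * (P.T * P.n ^ (j + 1))) := by gcongr
      _ = (3 * P.L + 4) * (P.N * (P.T * P.n ^ (j + 1))) := by ring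
      _ ≤ _ := by gcongr
  have h8 : (0 : ℝ) ≤ P.R j * P.n := by positivity
  have h9 : (3 * P.L + 5 : ℝ) ≤ 8 * P.L ^ 2 := by nlinarith
  nlinarith

/-- The regret of every level in every epoch of the level above, if no instance has too many failed
trials. -/
theorem sum_levelLoss_le {l : ℕ → Fin P.n → ℕ} (hl : ∀ t i, l t i ≤ P.T)
    (hl0 : ∀ t i, P.T ≤ t → l t i = 0) (X : ℕ → ℕ → Fin P.n) (i : Fin P.n)
    (hfail : ∀ j < P.k, ∀ I, P.instanceFailures l X i j I ≤ 2 * P.n * P.L ^ 2)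
    (j : ℕ) (hj : j ≤ P.k) (I : ℕ) :
    ∑ r ∈ range (P.E j), P.levelLoss l X j (I * P.E j + r) ≤
      ∑ r ∈ range (P.E j), l (I * P.E j + r) i + P.R j := by
  induction j generalizing I with
  | zero =>
    -- Base case: an epoch of level 0 has `N` days with losses at most `T`, and `R 0 = N T`.
    refine le_trans (sum_le_card_nsmul _ _ P.T fun r _ => P.levelLoss_le hl X 0 _) ?_
    simp [E, R]
  | succ j ih =>
    have hES : P.E (j + 1) = P.E j * P.N := by simp only [E]; ring
    have hηT : P.η j * P.T ≤ 1 := by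
      have hT : (0 : ℝ) < P.T := by exact_mod_cast P.T_pos
      have hn : (1 : ℝ) ≤ P.n := by exact_mod_cast P.n_pos
      rw [η, div_mul_eq_mul_div, one_mul, div_le_one (by positivity)]
      exact le_mul_of_one_le_right hT.le (one_le_pow₀ hn)
    have h1 := sum_loss_run_le P.q (P.R j) (P.E j) P.N (P.levelLoss l X j) l (X j) (P.η_pos j) hηT
      (P.E_pos j) P.N_pos P.q_pos (P.R_pos j) (P.levelLoss_le hl X j) hl I i (P.Active j I)
      (by
        intro s _ hna r _
        apply P.levelLoss_eq_zero
        intro i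
        apply hl0
        simp only [Active, start, not_lt] at hna
        omega)
      (by
        intro s _
        -- The epoch `s` of instance `I` is the epoch `I * N + s` in the global numbering used by
        -- the induction hypothesis.
        have := ih (by omega) (I * P.N + s)
        have h2 : (I * P.N + s) * P.E j = I * (P.E j * P.N) + s * P.E j := by ring
        rwa [h2] at this)
    have h2 : (P.instanceFailures l X i j I : ℝ) ≤ 2 * P.n * P.L ^ 2 := by
      exact_mod_cast hfail j (by omega) I
    have h3 := P.regret_step (j := j) (by omega)
    have h4 := mul_le_mul_of_nonneg_left h2 (Nat.cast_nonneg (α := ℝ) (P.R j))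
    rw [← hES] at h1
    simp only [instanceFailures, start, ← hES] at h4
    have h5 : (∑ r ∈ range (P.E (j + 1)), (P.levelLoss l X (j + 1) (I * P.E (j + 1) + r) : ℝ)) ≤
        ∑ r ∈ range (P.E (j + 1)), (l (I * P.E (j + 1) + r) i : ℝ) + P.R (j + 1) := by
      refine h1.trans ?_
      linarith
    exact_mod_cast h5

/-- By the choice of `k` the whole horizon lies in the first epoch of length `E k`, so the epoch
bound for strategy `k` is already the bound for the game; the days after `T` carry loss zero. -/
theorem T_le_E_k (hn : 1 < P.n) : P.T ≤ P.E P.k := by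
  have h : 1 < P.N := lt_of_lt_of_le hn (Nat.le_mul_of_pos_right _ P.q_pos)
  exact (Nat.lt_pow_succ_log_self h P.T).le

/-- The regret of the top level. -/
theorem sum_topLoss_le (hn : 1 < P.n) {l : ℕ → Fin P.n → ℕ} (hl : ∀ t i, l t i ≤ P.T)
    (hl0 : ∀ t i, P.T ≤ t → l t i = 0) (X : ℕ → ℕ → Fin P.n) (i : Fin P.n)
    (hfail : ∀ j < P.k, ∀ I, P.instanceFailures l X i j I ≤ 2 * P.n * P.L ^ 2) :
    ∑ t ∈ range P.T, P.levelLoss l X P.k t ≤ ∑ t ∈ range P.T, l t i + P.R P.k := by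
  have h := P.sum_levelLoss_le hl hl0 X i hfail P.k le_rfl 0
  obtain ⟨d, hd⟩ := Nat.exists_eq_add_of_le (P.T_le_E_k hn)
  simp only [zero_mul, zero_add, hd, sum_range_add] at h
  have h0 : ∑ r ∈ range d, l (P.T + r) i = 0 :=
    sum_eq_zero fun r _ => hl0 _ _ (Nat.le_add_right _ _)
  omega

end Params

/-! ### Sampling with finitely many fair bits. -/

section Sampling

open Finset

/-- A uniformly random element of `U` can be turned into an element of `ι` that takes each value `i`
on at least `c i` elements of `U`. -/
theorem exists_map_le_card_fiber {ι U : Type*} [Fintype ι] [Nonempty ι] [DecidableEq ι] [Fintype U]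
    (c : ι → ℕ) (hc : ∑ i, c i ≤ Fintype.card U) :
    ∃ f : U → ι, ∀ i, c i ≤ #{u | f u = i} := by
  classical
  -- Disjoint blocks of `c i` elements of `U` are assigned to the values `i`; the remaining elements
  -- are mapped arbitrarily.
  obtain ⟨φ⟩ : Nonempty ((Σ i, Fin (c i)) ↪ U) :=
    Function.Embedding.nonempty_of_card_le (by simpa using hc)
  refine ⟨fun u => if h : ∃ z, φ z = u then h.choose.1 else Classical.arbitrary ι, fun i => ?_⟩
  have h1 : c i = #(univ.image fun x : Fin (c i) => φ ⟨i, x⟩) := by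
    rw [card_image_of_injective]
    · simp
    · intro x y h
      simpa using φ.injective h
  rw [h1]
  apply card_le_card
  intro u hu
  obtain ⟨x, -, rfl⟩ := mem_image.1 hu
  have h : ∃ z, φ z = φ ⟨i, x⟩ := ⟨_, rfl⟩
  rw [mem_filter]
  beta_reduce
  rw [dif_pos h]
  exact ⟨mem_univ _, by rw [φ.injective h.choose_spec]⟩

/-- Giving each value at least the integer part of its share leaves at most one missing element per
value, so the expectation of a function with values in `[0, 1]` grows by at most `card ι / card U`.
-/
theorem exists_sampler {ι U : Type*} [Fintype ι] [Nonempty ι] [Fintype U] (p : ι → ℝ)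
    (hp : ∀ i, 0 ≤ p i) (hsum : ∑ i, p i = 1) :
    ∃ f : U → ι, ∀ h : ι → ℝ, (∀ i, 0 ≤ h i) → (∀ i, h i ≤ 1) →
      ∑ u, h (f u) ≤ Fintype.card U * ∑ i, p i * h i + Fintype.card ι := by
  classical
  set K : ℝ := (Fintype.card U : ℝ) with hK
  have hK0 : 0 ≤ K := by positivity
  set c : ι → ℕ := fun i => ⌊p i * K⌋₊ with hc
  have hc1 : ∀ i, (c i : ℝ) ≤ p i * K := fun i => Nat.floor_le (mul_nonneg (hp i) hK0)
  have hc2 : ∀ i, p i * K ≤ c i + 1 := fun i => (Nat.lt_floor_add_one _).le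
  obtain ⟨f, hf⟩ := exists_map_le_card_fiber (U := U) c (by
    have : (∑ i, (c i : ℝ)) ≤ K := by
      calc _ ≤ ∑ i, p i * K := sum_le_sum fun i _ => hc1 i
        _ = K := by rw [← sum_mul, hsum, one_mul]
    rw [hK] at this
    exact_mod_cast this)
  refine ⟨f, fun h h0 h1 => ?_⟩
  have hfib : ∑ u, h (f u) = ∑ i, (#{u | f u = i} : ℝ) * h i := by
    rw [← sum_fiberwise univ f]
    refine sum_congr rfl fun i _ => ?_
    rw [← nsmul_eq_mul, ← sum_const]
    refine sum_congr rfl fun u hu => ?_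
    rw [(mem_filter.1 hu).2]
  have htot : ∑ i, (#{u | f u = i} : ℝ) = K := by
    rw [hK, ← card_univ, card_eq_sum_card_fiberwise (f := f) (t := univ) (by simp)]
    push_cast
    rfl
  rw [hfib]
  calc ∑ i, (#{u | f u = i} : ℝ) * h i
      ≤ ∑ i, (p i * K * h i + (#{u | f u = i} - (p i * K - 1))) := by
        refine sum_le_sum fun i _ => ?_
        have h2 : (c i : ℝ) ≤ #{u | f u = i} := by exact_mod_cast hf i
        have h3 := hc2 i
        have h4 := h0 i
        have h5 := h1 i
        nlinarith
    _ = _ := by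
        rw [sum_add_distrib, sum_sub_distrib, sum_sub_distrib, htot, ← sum_mul, hsum, mul_sum]
        simp only [sum_const, card_univ, nsmul_eq_mul, mul_one, one_mul]
        have : ∑ i, p i * K * h i = ∑ i, K * (p i * h i) := sum_congr rfl fun i _ => by ring
        rw [this]
        ring

end Sampling

/-! ### Random draws and the number of failed trials. -/

namespace Params

open Finset LevelState Pool Function

variable (P : Params)

/-- A block of random bits. -/
abbrev Block : Type := Fin P.L → Bool

/-- The random bits of a run: block `(d, 0)` serves for the choice of an expert on day `d - 1`,
block `(d, j + 1)` for the expert that joins the pool of level `j` on day `d`. -/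
abbrev Blocks : Type := Fin (P.T + 1) × Fin (P.k + 1) → P.Block

theorem card_block : Fintype.card P.Block = 2 ^ P.L := by simp [Block]

theorem mul_le_card_block : P.n * P.T ≤ Fintype.card P.Block := by
  rw [card_block]
  exact P.mul_lt_two_pow_L.le

theorem exists_draw : ∃ f : P.Block → Fin P.n,
    ∀ i, Fintype.card P.Block / P.n ≤ #{u | f u = i} := by
  apply exists_map_le_card_fiber (fun _ => Fintype.card P.Block / P.n)
  simp only [sum_const, card_univ, Fintype.card_fin, smul_eq_mul]
  exact Nat.mul_div_le _ _

/-- A nearly uniformly random expert. -/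
noncomputable def draw : P.Block → Fin P.n := P.exists_draw.choose

/-- Each expert receives the integer part of `card Block / n`; as `card Block ≥ n`, rounding down
loses at most a factor two. -/
theorem le_card_draw (i : Fin P.n) :
    1 / (2 * P.n : ℝ) * Fintype.card P.Block ≤ #{u | P.draw u = i} := by
  have h1 := P.exists_draw.choose_spec i
  have h2 : P.n ≤ Fintype.card P.Block :=
    (Nat.le_mul_of_pos_right _ P.T_pos).trans P.mul_le_card_block
  have h3 : 0 < Fintype.card P.Block / P.n := Nat.div_pos h2 P.n_pos
  have h4 := Nat.lt_div_mul_add P.n_pos (a := Fintype.card P.Block)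
  have h5 : Fintype.card P.Block ≤ 2 * P.n * #{u | P.draw u = i} := by
    have h6 : Fintype.card P.Block ≤ 2 * P.n * (Fintype.card P.Block / P.n) := by nlinarith
    exact h6.trans (Nat.mul_le_mul_left _ h1)
  have hn : (0 : ℝ) < P.n := by exact_mod_cast P.n_pos
  rw [div_mul_eq_mul_div, one_mul, div_le_iff₀ (by positivity), mul_comm]
  exact_mod_cast h5

/-- The expert drawn by level `j` on day `d`. -/
noncomputable def drawn (ψ : P.Blocks) (j d : ℕ) : Fin P.n :=
  if h : d < P.T + 1 ∧ j < P.k then P.draw (ψ (⟨d, h.1⟩, ⟨j + 1, by omega⟩)) else 0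

theorem drawn_update_of_ne (ψ : P.Blocks) (c : Fin (P.T + 1) × Fin (P.k + 1)) (u : P.Block)
    (j d : ℕ) (h : c.1.val ≠ d ∨ c.2.val ≠ j + 1) :
    P.drawn (update ψ c u) j d = P.drawn ψ j d := by
  unfold drawn
  split_ifs with h'
  · rw [update_of_ne]
    rintro rfl
    simp at h
  · rfl

open scoped Classical in
/-- Many failed trials are unlikely. -/
theorem card_instanceFailures_le (l : ℕ → Fin P.n → ℕ) (i : Fin P.n) {j : ℕ} (hj : j < P.k)
    (I M : ℕ) :
    (#{ψ : P.Blocks | M ≤ P.instanceFailures l (P.drawn ψ) i j I} : ℝ) ≤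
      (1 - 1 / (2 * P.n : ℝ)) ^ M * Fintype.card P.Blocks := by
  set day : ℕ → ℕ := fun s => P.start j I + s * P.E j with hday
  -- The block read at the start of epoch `s`. The minimum only gives inactive epochs a dummy value;
  -- `c` is injective on active ones.
  set c : ℕ → Fin (P.T + 1) × Fin (P.k + 1) := fun s =>
    (⟨min (day s) P.T, by omega⟩, ⟨j + 1, by omega⟩) with hc
  set D : ℕ → P.Blocks → Prop := fun s ψ =>
    Trial P.q (P.R j) (epochGain (P.R j) (P.E j) (P.levelLoss l (P.drawn ψ) j) l (P.start j I))
      (fun s => P.drawn ψ j (P.start j I + s * P.E j)) i P.N (P.Active j I) s with hD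
  have hlt : ∀ s r, s < r → day s < day r := by
    intro s r hsr
    simp only [hday]
    have := Nat.mul_lt_mul_of_pos_right hsr (P.E_pos j)
    omega
  have hcday : ∀ s, P.Active j I s → (c s).1.val = day s := by
    intro s hs
    have : day s < P.T := hs
    simp only [hc]
    omega
  have hdraw : ∀ s, P.Active j I s → ∀ ψ, P.drawn ψ j (day s) = P.draw (ψ (c s)) := by
    intro s hs ψ
    have h1 : day s < P.T := hs
    rw [drawn, dif_pos ⟨by omega, hj⟩]
    congr 2
    exact Prod.ext (Fin.ext (hcday s hs).symm) rfl
  have heq : ∀ ψ, P.instanceFailures l (P.drawn ψ) i j I =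
      failedTrials c D (fun u => P.draw u = i) P.N ψ := by
    intro ψ
    simp only [instanceFailures, failures, failedTrials]
    congr 1
    refine filter_congr fun s _ => ?_
    refine and_congr Iff.rfl (forall_congr' fun r => forall_congr' fun _ => ?_)
    refine forall_congr' fun hr => ?_
    have := hdraw r hr.2.1 ψ
    simp only [hday] at this
    rw [this]
  simp only [heq]
  have hn : (1 : ℝ) ≤ P.n := by exact_mod_cast P.n_pos
  refine card_le_failedTrials_le P.N M c (P.Active j I) D (fun u => P.draw u = i)
    (1 / (2 * P.n : ℝ)) ?_ (by convert P.le_card_draw i) (fun s ψ h => h.2.1) ?_ ?_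
  · rw [div_le_one (by positivity)]
    linarith
  · intro s r hs hr h
    have h1 := hcday s hs
    have h2 := hcday r hr
    rw [h, h2] at h1
    rcases lt_trichotomy s r with h3 | h3 | h3
    · have := hlt s r h3
      omega
    · exact h3
    · have := hlt r s h3
      omega
  · intro s r ψ u hsr hr
    simp only [hD]
    -- Resampling a block of level `j` leaves the lower levels, hence the gains, unchanged;
    -- `trial_congr` does the rest.
    have h1 : P.levelLoss l (P.drawn (update ψ (c r) u)) j = P.levelLoss l (P.drawn ψ) j := by
      apply P.levelLoss_congr
      intro j' hj'
      funext d
      apply P.drawn_update_of_ne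
      right
      simp only [hc]
      omega
    rw [h1]
    apply trial_congr
    intro s' hs'
    apply P.drawn_update_of_ne
    left
    rw [hcday r hr]
    exact (hlt s' r (by omega)).ne'

/-- Instances with number at least `T` begin after the last day, so the union bound needs only `T`
instances per level. -/
theorem instanceFailures_eq_zero (l : ℕ → Fin P.n → ℕ) (X : ℕ → ℕ → Fin P.n) (i : Fin P.n)
    {j I : ℕ} (hI : P.T ≤ I) : P.instanceFailures l X i j I = 0 := by
  classical
  rw [instanceFailures, failures, card_eq_zero, filter_eq_empty_iff]
  rintro s - ⟨⟨-, h, -⟩, -⟩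
  have h1 : I * 1 ≤ I * (P.E j * P.N) :=
    Nat.mul_le_mul_left _ (Nat.mul_pos (P.E_pos j) P.N_pos)
  simp only [Active, start] at h
  omega

theorem one_sub_pow_le : (1 - 1 / (2 * P.n : ℝ)) ^ (2 * P.n * P.L ^ 2) ≤
    Real.exp (-(P.L : ℝ) ^ 2) := by
  have hn : (1 : ℝ) ≤ P.n := by exact_mod_cast P.n_pos
  have h0 : 0 ≤ 1 - 1 / (2 * P.n : ℝ) := by
    rw [sub_nonneg, div_le_one (by positivity)]
    linarith
  calc _ ≤ Real.exp (-(1 / (2 * P.n : ℝ))) ^ (2 * P.n * P.L ^ 2) := by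
        gcongr
        exact Real.one_sub_le_exp_neg _
    _ = _ := by
        rw [← Real.exp_nat_mul]
        congr 1
        push_cast
        field_simp

end Params

/-! ### Linearity of the mixture and dependence on queried experts only. -/

namespace LevelState

open Finset Entry

variable {n : ℕ}

/-- The loss of the exponential weights algorithm is linear. -/
theorem sum_mul_mixedLoss (η : ℝ) (s : LevelState n) (p h : Fin n → ℝ) :
    ∑ i, s.mixedLoss η (p i) (fun e => if e = i then 1 else 0) * h i =
      s.mixedLoss η (∑ i, p i * h i) h := by
  have hlist : ∀ l : List (Entry n),
      ∑ i, (l.map fun e => Real.exp (-(η * e.cur)) * if e.expert = i then (1 : ℝ) else 0).sum * h i =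
        (l.map fun e => Real.exp (-(η * e.cur)) * h e.expert).sum := by
    intro l
    induction l with
    | nil => simp
    | cons e l ih =>
      simp only [List.map_cons, List.sum_cons, add_mul, sum_add_distrib, ih]
      simp
  simp only [mixedLoss, div_mul_eq_mul_div]
  rw [← sum_div, mul_sum, ← hlist s.pool, ← sum_add_distrib]
  congr 1
  exact sum_congr rfl fun i _ => by ring

theorem accumulate_congr {a : ℕ} {l l' : Fin n → ℕ} {s : LevelState n}
    (h : ∀ e ∈ s.pool, l e.expert = l' e.expert) : s.accumulate a l = s.accumulate a l' := by
  unfold accumulate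
  congr 1
  refine List.map_congr_left fun e he => ?_
  simp only [addLoss, h e he]

theorem step_congr (q R E N t a : ℕ) {l l' : Fin n → ℕ} (x : Fin n) {s : LevelState n}
    (h : ∀ e ∈ s.pool, l e.expert = l' e.expert) :
    step q R E N t a l x s = step q R E N t a l' x s := by
  unfold step
  rw [accumulate_congr h]

theorem loss_congr (η : ℝ) (a : ℕ) {l l' : Fin n → ℕ} {s : LevelState n}
    (h : ∀ e ∈ s.pool, l e.expert = l' e.expert) : s.loss η a l = s.loss η a l' := by
  unfold loss mixedLoss
  congr 4
  refine List.map_congr_left fun e he => ?_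
  simp only [h e he]

end LevelState

/-! ### The algorithm: distribution, memory encoding and run. -/

namespace Params

open Finset LevelState Pool Function

variable (P : Params)

/-- The number of the day and the states of all levels. -/
abbrev Memory : Type := ℕ × (ℕ → LevelState P.n)

/-- The loss of level `j` on a day on which expert `i` has loss `l i`. -/
noncomputable def dayLoss (s : ℕ → LevelState P.n) (l : Fin P.n → ℕ) : ℕ → ℕ
  | 0 => l 0
  | j + 1 => (s j).loss (P.η j) (dayLoss s l j) l

/-- The states of the levels after day `t`. -/
noncomputable def next (t : ℕ) (s : ℕ → LevelState P.n) (l : Fin P.n → ℕ) (x : ℕ → Fin P.n) :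
    ℕ → LevelState P.n := fun j =>
  if j < P.k then step P.q (P.R j) (P.E j) P.N t (P.dayLoss s l j) l (x j) (s j) else ⟨0, []⟩

/-- The names of the experts in memory. -/
def experts (s : ℕ → LevelState P.n) : List (Fin P.n) :=
  0 :: (List.range P.k).flatMap fun j => (s j).pool.map Entry.expert

theorem mem_experts {s : ℕ → LevelState P.n} {j : ℕ} (hj : j < P.k) {e : Entry P.n}
    (he : e ∈ (s j).pool) : e.expert ∈ P.experts s := by
  refine List.mem_cons_of_mem _ (List.mem_flatMap.2 ⟨j, List.mem_range.2 hj, ?_⟩)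
  exact List.mem_map_of_mem he

theorem dayLoss_congr {s : ℕ → LevelState P.n} {l l' : Fin P.n → ℕ}
    (h : ∀ i ∈ P.experts s, l i = l' i) {j : ℕ} (hj : j ≤ P.k) :
    P.dayLoss s l j = P.dayLoss s l' j := by
  induction j with
  | zero => exact h 0 (by simp [experts])
  | succ j ih =>
    rw [dayLoss, dayLoss, ih (by omega)]
    exact loss_congr _ _ fun e he => h _ (P.mem_experts hj he)

/-- The update uses the losses of the experts named in memory only, so observing the queried experts
suffices. -/
theorem next_congr (t : ℕ) {s : ℕ → LevelState P.n} {l l' : Fin P.n → ℕ} (x : ℕ → Fin P.n)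
    (h : ∀ i ∈ P.experts s, l i = l' i) : P.next t s l x = P.next t s l' x := by
  funext j
  unfold next
  split_ifs with hj
  · rw [P.dayLoss_congr h hj.le]
    exact step_congr _ _ _ _ _ _ _ fun e he => h _ (P.mem_experts hj he)
  · rfl

/-- The distribution of the expert followed by level `j`. -/
noncomputable def dist (s : ℕ → LevelState P.n) : ℕ → Fin P.n → ℝ
  | 0 => fun i => if i = 0 then 1 else 0
  | j + 1 => fun i => (s j).mixedLoss (P.η j) (dist s j i) (fun e => if e = i then 1 else 0)

theorem dist_nonneg (s : ℕ → LevelState P.n) (j : ℕ) (i : Fin P.n) : 0 ≤ P.dist s j i := by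
  induction j with
  | zero => simp only [dist]; split_ifs <;> norm_num
  | succ j ih =>
    simp only [dist]
    exact mixedLoss_nonneg _ _ ih fun e => by positivity

theorem sum_dist (s : ℕ → LevelState P.n) (j : ℕ) : ∑ i, P.dist s j i = 1 := by
  induction j with
  | zero => simp [dist]
  | succ j ih =>
    have h := sum_mul_mixedLoss (P.η j) (s j) (P.dist s j) (fun _ => 1)
    simp only [mul_one, ih] at h
    simp only [dist]
    rw [h]
    simp only [mixedLoss, mul_one]
    exact div_self (norm_pos _ _).ne'

theorem dist_eq_zero {s : ℕ → LevelState P.n} {j : ℕ} (hj : j ≤ P.k) {i : Fin P.n}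
    (hi : i ∉ P.experts s) : P.dist s j i = 0 := by
  induction j with
  | zero =>
    simp only [dist]
    rw [if_neg]
    rintro rfl
    exact hi (by simp [experts])
  | succ j ih =>
    simp only [dist, mixedLoss]
    rw [ih (by omega)]
    have : ((s j).pool.map fun e => Real.exp (-(P.η j * e.cur)) *
        if e.expert = i then (1 : ℝ) else 0) = (s j).pool.map fun _ => 0 := by
      refine List.map_congr_left fun e he => ?_
      rw [if_neg, mul_zero]
      rintro rfl
      exact hi (P.mem_experts (by omega) he)
    rw [this]
    simp

/-- The mixture is linear in the losses, and every level only rounds up; so the rounded loss of a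
level dominates the expected loss of an expert drawn from its distribution. -/
theorem sum_dist_mul_le (s : ℕ → LevelState P.n) (l : Fin P.n → ℕ) (j : ℕ) :
    ∑ i, P.dist s j i * (l i : ℝ) ≤ P.dayLoss s l j := by
  induction j with
  | zero => simp [dist, dayLoss]
  | succ j ih =>
    simp only [dist, dayLoss]
    rw [sum_mul_mixedLoss]
    exact (mixedLoss_mono _ _ ih _).trans (Nat.le_ceil _)

/-- The sampler is applied on the queried experts, where the whole distribution lives; there are at
most `n` of them, hence the error term. -/
theorem exists_follow (s : ℕ → LevelState P.n) : ∃ f : P.Block → {e // e ∈ (P.experts s).toFinset},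
    ∀ h : Fin P.n → ℝ, (∀ i, 0 ≤ h i) → (∀ i, h i ≤ 1) →
      ∑ u, h (f u) ≤ Fintype.card P.Block * ∑ i, P.dist s P.k i * h i + P.n := by
  have hsub : ∀ g : Fin P.n → ℝ, (∀ i, i ∉ P.experts s → g i = 0) →
      ∑ e : {e // e ∈ (P.experts s).toFinset}, g e = ∑ i, g i := by
    intro g hg
    rw [Finset.sum_coe_sort (P.experts s).toFinset g]
    refine sum_subset (subset_univ _) fun i _ hi => hg i ?_
    simpa using hi
  have : Nonempty {e // e ∈ (P.experts s).toFinset} := ⟨⟨0, by simp [experts]⟩⟩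
  obtain ⟨f, hf⟩ := exists_sampler (U := P.Block)
    (fun e : {e // e ∈ (P.experts s).toFinset} => P.dist s P.k e)
    (fun e => P.dist_nonneg s _ _)
    (by rw [hsub _ fun i hi => P.dist_eq_zero le_rfl hi, P.sum_dist])
  refine ⟨f, fun h h0 h1 => ?_⟩
  have h2 := hf (fun e => h e) (fun e => h0 e) (fun e => h1 e)
  rw [hsub (fun i => P.dist s P.k i * h i) fun i hi => by
    rw [P.dist_eq_zero le_rfl hi, zero_mul]] at h2
  refine h2.trans ?_
  gcongr
  rw [Fintype.card_coe]
  simpa using card_le_univ (P.experts s).toFinset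

/-- The expert followed, as a function of the random bits. -/
noncomputable def follow (s : ℕ → LevelState P.n) : P.Block → {e // e ∈ (P.experts s).toFinset} :=
  (P.exists_follow s).choose

/-! ### The size of the memory -/

/-- A strict upper bound for all counters. -/
def V : ℕ := P.N + P.N * P.R P.k + P.N ^ P.k * P.T + 1

/-- The maximal size of a pool. -/
def m : ℕ := P.q * (2 * P.L + 1) + 1

/-- The counters and the pool of a level are within their bounds. -/
def SmallLevel (s : LevelState P.n) : Prop :=
  s.lower < P.V ∧ s.pool.length ≤ P.m ∧
    ∀ e ∈ s.pool, e.age < P.V ∧ e.gain < P.V ∧ e.bench < P.V ∧ e.cur < P.V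

/-- All counters and pools are within their bounds. -/
def Small (s : P.Memory) : Prop :=
  s.1 < P.T + 1 ∧ (∀ j < P.k, P.SmallLevel (s.2 j)) ∧ ∀ j, P.k ≤ j → s.2 j = ⟨0, []⟩

instance : NeZero P.V := ⟨Nat.succ_ne_zero _⟩

/-- The codes of entries. -/
abbrev EntryCode : Type := Fin P.n × Fin P.V × Fin P.V × Fin P.V × Fin P.V

/-- The codes of small memory contents. -/
abbrev Code : Type :=
  Fin (P.T + 1) × (Fin P.k → Fin P.V × (Fin P.m → Option P.EntryCode))

/-- The code of an entry. -/
def entryCode (e : Entry P.n) : P.EntryCode :=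
  (e.expert, Fin.ofNat _ e.age, Fin.ofNat _ e.gain, Fin.ofNat _ e.bench, Fin.ofNat _ e.cur)

/-- The code of a memory content. -/
def code (s : P.Memory) : P.Code :=
  (Fin.ofNat _ s.1, fun j => (Fin.ofNat _ (s.2 j).lower,
    fun b => ((s.2 j).pool[b.val]?).map P.entryCode))

theorem ofNat_inj {b x y : ℕ} [NeZero b] (hx : x < b) (hy : y < b)
    (h : Fin.ofNat b x = Fin.ofNat b y) : x = y := by
  have := congrArg Fin.val h
  simpa [Fin.ofNat, Nat.mod_eq_of_lt hx, Nat.mod_eq_of_lt hy] using this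

/-- The code reduces counters modulo their bounds and cuts pools at `m` entries, and on small
contents neither loses information. -/
theorem code_injOn {s s' : P.Memory} (hs : P.Small s) (hs' : P.Small s')
    (h : P.code s = P.code s') : s = s' := by
  obtain ⟨h1, h2, h3⟩ := hs
  obtain ⟨h1', h2', h3'⟩ := hs'
  simp only [code, Prod.mk.injEq] at h
  obtain ⟨ht, hlev⟩ := h
  refine Prod.ext (ofNat_inj h1 h1' ht) (funext fun j => ?_)
  by_cases hj : j < P.k
  · have hj' := congrFun hlev ⟨j, hj⟩
    simp only [Prod.mk.injEq] at hj'
    obtain ⟨hlow, hpool⟩ := hj'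
    obtain ⟨a1, a2, a3⟩ := h2 j hj
    obtain ⟨b1, b2, b3⟩ := h2' j hj
    refine LevelState.ext (ofNat_inj a1 b1 hlow) (List.ext_getElem? fun b => ?_)
    by_cases hb : b < P.m
    · have h4 := congrFun hpool ⟨b, hb⟩
      simp only at h4
      rcases h5 : (s.2 j).pool[b]? with _ | e <;> rcases h6 : (s'.2 j).pool[b]? with _ | e' <;>
        rw [h5, h6] at h4
      · simp at h4
      · simp at h4
      · have h7 := a3 e (List.mem_of_getElem? h5)
        have h8 := b3 e' (List.mem_of_getElem? h6)
        simp only [Option.map_some, Option.some.injEq, entryCode, Prod.mk.injEq] at h4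
        obtain ⟨c1, c2, c3, c4, c5⟩ := h4
        rw [Entry.ext c1 (ofNat_inj h7.1 h8.1 c2) (ofNat_inj h7.2.1 h8.2.1 c3)
          (ofNat_inj h7.2.2.1 h8.2.2.1 c4) (ofNat_inj h7.2.2.2 h8.2.2.2 c5)]
    · rw [List.getElem?_eq_none (by omega), List.getElem?_eq_none (by omega)]
  · rw [h3 j (by omega), h3' j (by omega)]

/-- The number of bits in a code. -/
def codeLength : ℕ := Nat.clog 2 (Fintype.card P.Code)

theorem exists_bits : Nonempty (P.Code ↪ (Fin P.codeLength → Bool)) := by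
  apply Function.Embedding.nonempty_of_card_le
  rw [Fintype.card_fun, Fintype.card_bool, Fintype.card_fin]
  exact Nat.le_pow_clog (by norm_num) _

/-- The code as a string of bits. -/
noncomputable def bits : P.Code ↪ (Fin P.codeLength → Bool) := P.exists_bits.some

theorem two_le_wordSize : 2 ≤ 2 ^ (Nat.log 2 (P.n * P.T) + 1) := by
  rw [pow_succ]
  have := Nat.one_le_two_pow (n := Nat.log 2 (P.n * P.T))
  omega

/-- The name of an expert as a word of memory. -/
def expertWord (e : Fin P.n) : Word P.n P.T := ⟨e.val, e.isLt.trans P.n_lt⟩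

/-- A bit as a word of memory. -/
def bitWord (b : Bool) : Word P.n P.T :=
  ⟨b.toNat, lt_of_lt_of_le (by cases b <;> simp) P.two_le_wordSize⟩

/-- The words of memory: the names of the experts and the bits of the code. -/
noncomputable def memoryWords (s : P.Memory) : List (Word P.n P.T) :=
  (P.experts s.2).map P.expertWord ++ List.ofFn fun b => P.bitWord (P.bits (P.code s) b)

theorem memoryWords_injOn {s s' : P.Memory} (hs : P.Small s) (hs' : P.Small s')
    (h : P.memoryWords s = P.memoryWords s') : s = s' := by
  have h1 := List.append_inj_right' h (by simp)
  have h2 := List.ofFn_injective h1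
  refine P.code_injOn hs hs' (P.bits.injective (funext fun b => ?_))
  have h3 := congrFun h2 b
  simp only [bitWord, Fin.mk.injEq] at h3
  generalize P.bits (P.code s) b = x at h3
  generalize P.bits (P.code s') b = y at h3
  cases x <;> cases y <;> simp at h3 ⊢

theorem small_default : P.Small (0, fun _ => ⟨0, []⟩) := by
  refine ⟨by simp, fun j _ => ⟨?_, by simp, by simp⟩, fun _ _ => rfl⟩
  exact Nat.succ_pos _

open scoped Classical in
/-- Memory contents that are too large are replaced by a default value. -/
noncomputable def clip (s : P.Memory) : {s : P.Memory // P.Small s} :=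
  if h : P.Small s then ⟨s, h⟩ else ⟨_, P.small_default⟩

/-- The blocks of random bits of a day. -/
def blocks : (Fin ((P.k + 1) * P.L) → Bool) ≃ (Fin (P.k + 1) → P.Block) :=
  (Equiv.arrowCongr finProdFinEquiv.symm (Equiv.refl Bool)).trans (Equiv.curry _ _ _)

/-- The blocks of random bits of a run. -/
def tapeBlocks : (Fin (P.T + 1) → Fin ((P.k + 1) * P.L) → Bool) ≃ P.Blocks :=
  (Equiv.piCongrRight fun _ => P.blocks).trans (Equiv.curry _ _ _).symm

/-- The expert drawn by level `j` from the random bits of a day. -/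
noncomputable def drawBits (w : Fin ((P.k + 1) * P.L) → Bool) (j : ℕ) : Fin P.n :=
  if h : j < P.k then P.draw (P.blocks w ⟨j + 1, by omega⟩) else 0

open scoped Classical in
/-- The losses of the queried experts, rounded to multiples of `1 / T`. -/
noncomputable def quantize (S : Finset (Fin P.n)) (l : {e // e ∈ S} → unitInterval)
    (e : Fin P.n) : ℕ :=
  if h : e ∈ S then ⌊(P.T : ℝ) * l ⟨e, h⟩⌋₊ else 0

/-- The algorithm. -/
noncomputable def algorithm : ExpertAlgorithm P.n P.T where
  State := {s : P.Memory // P.Small s}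
  words s := P.memoryWords s.1
  words_injective s s' h := Subtype.ext (P.memoryWords_injOn s.2 s'.2 h)
  query s := (P.experts s.1.2).toFinset
  query_stored s e he := by
    refine ⟨P.expertWord e, List.mem_append_left _ (List.mem_map_of_mem ?_), rfl⟩
    simpa using he
  numBits := (P.k + 1) * P.L
  init w := P.clip (0, fun j => if j < P.k then ⟨0, [Entry.fresh (P.drawBits w j)]⟩ else ⟨0, []⟩)
  play s _ w := P.follow s.1.2 (P.blocks w 0)
  update s _ l w := P.clip (s.1.1 + 1, P.next s.1.1 s.1.2 (P.quantize _ l) (P.drawBits w))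

/-! ### The run of the algorithm -/

/-- The memory content at the beginning of day `t`. -/
noncomputable def memory (l : ℕ → Fin P.n → ℕ) (X : ℕ → ℕ → Fin P.n) (t : ℕ) : P.Memory :=
  (t, fun j => if j < P.k then P.levelState l X j t else ⟨0, []⟩)

theorem dayLoss_memory (l : ℕ → Fin P.n → ℕ) (X : ℕ → ℕ → Fin P.n) (t : ℕ) {j : ℕ}
    (hj : j ≤ P.k) : P.dayLoss (P.memory l X t).2 (l t) j = P.levelLoss l X j t := by
  induction j with
  | zero => rfl
  | succ j ih =>
    rw [dayLoss, ih (by omega), levelLoss]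
    simp only [memory, if_pos (show j < P.k by omega)]
    rfl

theorem next_memory (l : ℕ → Fin P.n → ℕ) (X : ℕ → ℕ → Fin P.n) (t : ℕ) {x : ℕ → Fin P.n}
    (hx : ∀ j < P.k, x j = X j (t + 1)) :
    P.next t (P.memory l X t).2 (l t) x = (P.memory l X (t + 1)).2 := by
  funext j
  by_cases hj : j < P.k
  · simp only [next, if_pos hj, P.dayLoss_memory l X t hj.le, hx j hj]
    simp only [memory, if_pos hj]
    rfl
  · simp [next, memory, hj]

theorem R_mono {i j : ℕ} (h : i ≤ j) : P.R i ≤ P.R j := by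
  have hn := P.n_pos
  have hL := P.L_pos
  exact Nat.mul_le_mul_left _ (Nat.pow_le_pow_right (by positivity) h)

/-- Every day is written as instance, epoch and day in the epoch. The pool bound then limits the
list, the epoch bounds limit the records, and at most `E j ≤ N ^ k` daily losses are added within an
epoch. -/
theorem smallLevel_levelState {l : ℕ → Fin P.n → ℕ} (hl : ∀ t i, l t i ≤ P.T)
    (X : ℕ → ℕ → Fin P.n) {j : ℕ} (hj : j < P.k) (t : ℕ) :
    P.SmallLevel (P.levelState l X j t) := by
  have hEN : 0 < P.E j * P.N := Nat.mul_pos (P.E_pos j) P.N_pos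
  obtain ⟨I, s, r, hs, hr, rfl⟩ : ∃ I s r, s < P.N ∧ r < P.E j ∧
      t = I * (P.E j * P.N) + s * P.E j + r := by
    refine ⟨t / (P.E j * P.N), t % (P.E j * P.N) / P.E j, t % (P.E j * P.N) % P.E j,
      Nat.div_lt_of_lt_mul (Nat.mod_lt _ hEN), Nat.mod_lt _ (P.E_pos j), ?_⟩
    have h1 := Nat.div_add_mod t (P.E j * P.N)
    have h2 := Nat.div_add_mod (t % (P.E j * P.N)) (P.E j)
    rw [mul_comm (t / _), mul_comm (_ / P.E j), add_assoc, h2, h1]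
  rw [levelState, run_instance_day _ _ _ _ _ _ _ (P.E_pos j) P.N_pos I s r hs hr]
  set G := epochGain (P.R j) (P.E j) (P.levelLoss l X j) l (I * (P.E j * P.N)) with hG
  set X' : ℕ → Fin P.n := fun s => X j (I * (P.E j * P.N) + s * P.E j)
  have hGR : ∀ s i, G s i ≤ P.R j := fun s i => min_le_left _ _
  have hET : r * P.T ≤ P.N ^ P.k * P.T :=
    Nat.mul_le_mul_right _ (hr.le.trans (Nat.pow_le_pow_right P.N_pos hj))
  have hNR : s * P.R j ≤ P.N * P.R P.k := Nat.mul_le_mul hs.le (P.R_mono hj.le)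
  have hsum : ∀ f : ℕ → ℕ, (∀ t, f t ≤ P.T) →
      ∑ k ∈ range r, f (I * (P.E j * P.N) + s * P.E j + k) < P.V := by
    intro f hf
    have := sum_le_card_nsmul (range r) (fun k => f (I * (P.E j * P.N) + s * P.E j + k)) P.T
      fun k _ => hf _
    simp only [card_range, smul_eq_mul] at this
    unfold V
    omega
  refine ⟨hsum _ fun t => P.levelLoss_le hl X j t, ?_, ?_⟩
  · have h1 := length_older_le P.q (P.R j) G X' (P.R_pos j) hGR s P.N hs.le
    have h2 : (P.q : ℝ) * (1 + Real.log P.N) ≤ P.q * (2 * P.L + 1) := by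
      exact mul_le_mul_of_nonneg_left (by linarith [P.log_N_le]) (Nat.cast_nonneg _)
    have h3 : (older P.q (P.R j) G X' s).length ≤ P.q * (2 * P.L + 1) := by
      exact_mod_cast h1.trans h2
    simp only [during, List.length_map, Pool.pool, List.length_cons, m]
    omega
  · intro e he
    obtain ⟨e₀, h0, rfl⟩ := List.mem_map.1 he
    have h1 : e₀.age ≤ s ∧ e₀.gain ≤ s * P.R j ∧ e₀.bench ≤ s * P.R j ∧ e₀.cur = 0 := by
      rcases List.mem_cons.1 h0 with rfl | h
      · simp [Entry.fresh]
      · exact records_older_le P.q (P.R j) G X' hGR s e₀ h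
    have h2 := hsum (fun t => l t e₀.expert) fun t => hl t _
    obtain ⟨a1, a2, a3, a4⟩ := h1
    refine ⟨?_, ?_, ?_, ?_⟩
    · simp only [Entry.addLoss]; unfold V; omega
    · simp only [Entry.addLoss]; unfold V; omega
    · simp only [Entry.addLoss]; unfold V; omega
    · simpa only [Entry.addLoss, a4, zero_add] using h2

theorem small_memory {l : ℕ → Fin P.n → ℕ} (hl : ∀ t i, l t i ≤ P.T)
    (X : ℕ → ℕ → Fin P.n) {t : ℕ} (ht : t ≤ P.T) : P.Small (P.memory l X t) := by
  refine ⟨by simp only [memory]; omega, fun j hj => ?_, fun j hj => ?_⟩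
  · simp only [memory, if_pos hj]
    exact P.smallLevel_levelState hl X hj t
  · simp only [memory]
    rw [if_neg (by omega)]

/-- The losses, rounded to multiples of `1 / T` and extended by zero. -/
noncomputable def roundedLoss (l : Fin P.T → Fin P.n → unitInterval) (t : ℕ) (i : Fin P.n) : ℕ :=
  if h : t < P.T then ⌊(P.T : ℝ) * l ⟨t, h⟩ i⌋₊ else 0

theorem roundedLoss_le (l : Fin P.T → Fin P.n → unitInterval) (t : ℕ) (i : Fin P.n) :
    P.roundedLoss l t i ≤ P.T := by
  unfold roundedLoss
  split_ifs with h
  · apply Nat.floor_le_of_le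
    exact mul_le_of_le_one_right (by positivity) (l _ i).2.2
  · exact Nat.zero_le _

theorem roundedLoss_eq_zero (l : Fin P.T → Fin P.n → unitInterval) (t : ℕ) (i : Fin P.n)
    (h : P.T ≤ t) : P.roundedLoss l t i = 0 := dif_neg (by omega)

theorem drawBits_eq_drawn (ω : P.algorithm.Tape) (d : Fin (P.T + 1)) {j : ℕ} (hj : j < P.k) :
    P.drawBits (ω d) j = P.drawn (P.tapeBlocks ω) j d := by
  unfold drawBits drawn
  rw [dif_pos hj, dif_pos ⟨d.2, hj⟩]
  rfl

/-- Along an actual run the contents are always small, so `clip` never acts, and the rounded losses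
agree with the observed ones on every queried expert. -/
theorem state_eq (x l : Fin P.T → Fin P.n → unitInterval) (ω : P.algorithm.Tape)
    (t : Fin (P.T + 1)) : (P.algorithm.state x l ω t).1 =
      P.memory (P.roundedLoss l) (P.drawn (P.tapeBlocks ω)) t := by
  have hclip : ∀ s, P.Small s → (P.clip s).1 = s := fun s hs => by rw [clip, dif_pos hs]
  induction t using Fin.induction with
  | zero =>
    have h0 : P.algorithm.state x l ω 0 = P.algorithm.init (ω 0) := rfl
    have h1 : ((0, fun j => if j < P.k then ⟨0, [Entry.fresh (P.drawBits (ω 0) j)]⟩ else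
        ⟨0, []⟩) : P.Memory) = P.memory (P.roundedLoss l) (P.drawn (P.tapeBlocks ω)) 0 := by
      refine Prod.ext rfl (funext fun j => ?_)
      simp only [memory]
      split_ifs with hj
      · rw [P.drawBits_eq_drawn ω 0 hj]
        rfl
      · rfl
    rw [h0]
    simp only [algorithm]
    rw [h1]
    exact hclip _ (P.small_memory (P.roundedLoss_le l) _ (Nat.zero_le _))
  | succ t ih =>
    have h0 : P.algorithm.state x l ω t.succ = P.algorithm.update (P.algorithm.state x l ω t.castSucc)
        (fun e => x t e.1) (fun e => l t e.1) (ω t.succ) := rfl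
    rw [h0]
    generalize P.algorithm.state x l ω t.castSucc = s at ih
    simp only [algorithm] at s ih ⊢
    have h1 : P.next s.1.1 s.1.2 (P.quantize (P.experts s.1.2).toFinset fun e => l t e.1)
        (P.drawBits (ω t.succ)) =
        (P.memory (P.roundedLoss l) (P.drawn (P.tapeBlocks ω)) (t + 1)).2 := by
      rw [P.next_congr (l' := P.roundedLoss l t)]
      · rw [ih]
        exact P.next_memory _ _ t fun j hj => P.drawBits_eq_drawn ω t.succ hj
      · intro i hi
        rw [quantize, roundedLoss, dif_pos (by simpa using hi), dif_pos t.2]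
    rw [hclip]
    · rw [h1, ih]
      rfl
    · rw [h1, ih]
      exact P.small_memory (P.roundedLoss_le l) (P.drawn (P.tapeBlocks ω)) (t := t + 1) (by omega)

theorem played_eq (x l : Fin P.T → Fin P.n → unitInterval) (ω : P.algorithm.Tape) (t : Fin P.T) :
    P.algorithm.played x l ω t = (P.follow (P.memory (P.roundedLoss l)
      (P.drawn (P.tapeBlocks ω)) t).2 (P.tapeBlocks ω (t.succ, 0))).1 := by
  have h : P.algorithm.played x l ω t = (P.follow (P.algorithm.state x l ω t.castSucc).1.2
    (P.tapeBlocks ω (t.succ, 0))).1 := rfl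
  rw [h, state_eq]
  rfl

end Params

/-! ### From counting to probability; space and regret of the algorithm. -/

/-- A lower bound for a probability from a set `B` that contains all bad outcomes. -/
theorem ExpertAlgorithm.one_sub_le_prob {n T : ℕ} (A : ExpertAlgorithm n T) {β : Type*} [Fintype β]
    (φ : A.Tape ≃ β) (S : Set A.Tape) (B : Finset β) (hB : ∀ ω, φ ω ∉ B → ω ∈ S) (ε : ℝ)
    (h : (B.card : ℝ) ≤ ε * Fintype.card β) : 1 - ε ≤ A.prob S := by
  classical
  rw [← Fintype.card_congr φ] at h
  have hS : MeasurableSet S := S.toFinite.measurableSet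
  have hcard : (0 : ℝ) < Fintype.card A.Tape := by exact_mod_cast Fintype.card_pos
  have h1 : A.prob S = (Finset.card {ω : A.Tape | ω ∈ S} : ℝ) / Fintype.card A.Tape := by
    rw [prob, MeasureTheory.measureReal_def, PMF.toMeasure_uniformOfFintype_apply _ hS,
      ENNReal.toReal_div, ENNReal.toReal_natCast, ENNReal.toReal_natCast, Fintype.card_subtype]
  have h2 : Fintype.card A.Tape ≤ Finset.card {ω : A.Tape | ω ∈ S} + B.card := by
    rw [← Finset.card_univ]
    rw [← Finset.card_map φ.symm.toEmbedding (s := B)]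
    refine le_trans (Finset.card_le_card fun ω _ => ?_) (Finset.card_union_le _ _)
    by_cases hω : φ ω ∈ B
    · simp [hω]
    · simp [hB ω hω]
  have h3 : (Fintype.card A.Tape : ℝ) ≤ Finset.card {ω : A.Tape | ω ∈ S} + B.card := by
    exact_mod_cast h2
  rw [h1, le_div_iff₀ hcard]
  linarith

theorem ExpertAlgorithm.prob_nonneg {n T : ℕ} (A : ExpertAlgorithm n T) (S : Set A.Tape) :
    0 ≤ A.prob S := MeasureTheory.measureReal_nonneg

theorem ExpertAlgorithm.regret_le {n T : ℕ} (A : ExpertAlgorithm n T)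
    (x l : Fin T → Fin n → unitInterval) (ω : A.Tape) : A.regret x l ω ≤ T := by
  have h1 : ∑ t, (l t (A.played x l ω t) : ℝ) ≤ ∑ _t : Fin T, (1 : ℝ) :=
    Finset.sum_le_sum fun t _ => (l t _).2.2
  have h2 : 0 ≤ ⨅ i : Fin n, ∑ t, (l t i : ℝ) :=
    Real.iInf_nonneg fun i => Finset.sum_nonneg fun t _ => (l t i).2.1
  simp only [Finset.sum_const, Finset.card_univ, Fintype.card_fin, nsmul_eq_mul, mul_one] at h1
  rw [regret]
  linarith

namespace Params

open Finset LevelState Pool Function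

variable (P : Params)

/-! ### Space -/

/-- Regret bounds grow by a factor with `O(L)` bits per level, so counters have `O(L (k + 1))` bits.
-/
theorem V_le : P.V ≤ 2 ^ (7 * P.L * (P.k + 1)) := by
  have hL := P.L_pos
  have hn := P.n_lt.le
  have hT := P.T_lt.le
  have hN : P.N ≤ 2 ^ (2 * P.L) := by
    rw [mul_comm, pow_mul]
    exact P.N_le.trans (Nat.pow_le_pow_left hn 2)
  have hLL : 10 * P.L ^ 2 ≤ 2 ^ (6 * P.L) := by
    calc 10 * P.L ^ 2 ≤ 2 ^ (4 * P.L) * (2 ^ P.L) ^ 2 := by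
          apply Nat.mul_le_mul
          · calc 10 ≤ 2 ^ 4 := by norm_num
              _ ≤ _ := Nat.pow_le_pow_right (by norm_num) (by omega)
          · exact Nat.pow_le_pow_left Nat.lt_two_pow_self.le 2
      _ = _ := by rw [← pow_mul, ← pow_add]; congr 1; ring
  have hR : P.R P.k ≤ 2 ^ (3 * P.L + 7 * P.L * P.k) := by
    calc P.R P.k ≤ 2 ^ (2 * P.L) * 2 ^ P.L * (2 ^ P.L * 2 ^ (6 * P.L)) ^ P.k := by
          unfold R
          gcongr
      _ = _ := by rw [← pow_add, ← pow_add, ← pow_mul, ← pow_add]; congr 1; ring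
  have hNk : P.N ^ P.k ≤ 2 ^ P.L := (Nat.pow_log_le_self _ P.T_pos.ne').trans hT
  have h1 : P.N * P.R P.k ≤ 2 ^ (5 * P.L + 7 * P.L * P.k) := by
    calc _ ≤ 2 ^ (2 * P.L) * 2 ^ (3 * P.L + 7 * P.L * P.k) := Nat.mul_le_mul hN hR
      _ = _ := by rw [← pow_add]; congr 1; ring
  have h2 : P.N ^ P.k * P.T ≤ 2 ^ (5 * P.L + 7 * P.L * P.k) := by
    calc _ ≤ 2 ^ P.L * 2 ^ P.L := Nat.mul_le_mul hNk hT
      _ = 2 ^ (2 * P.L) := by rw [← pow_add]; congr 1; ring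
      _ ≤ _ := Nat.pow_le_pow_right (by norm_num) (by nlinarith [Nat.zero_le (P.L * P.k)])
  have h3 : P.N ≤ 2 ^ (5 * P.L + 7 * P.L * P.k) :=
    hN.trans (Nat.pow_le_pow_right (by norm_num) (by nlinarith [Nat.zero_le (P.L * P.k)]))
  have h4 : 1 ≤ 2 ^ (5 * P.L + 7 * P.L * P.k) := Nat.one_le_two_pow
  calc P.V ≤ 2 ^ 2 * 2 ^ (5 * P.L + 7 * P.L * P.k) := by
        unfold V
        omega
    _ = 2 ^ (2 + (5 * P.L + 7 * P.L * P.k)) := by rw [pow_add 2 2]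
    _ ≤ _ := Nat.pow_le_pow_right (by norm_num) (by nlinarith)

theorem codeLength_le : P.codeLength ≤ P.L + P.k * (7 * P.L * (P.k + 1) +
    P.m * (P.L + 4 * (7 * P.L * (P.k + 1)) + 1)) := by
  set β := 7 * P.L * (P.k + 1) with hβ
  have hV : P.V ≤ 2 ^ β := P.V_le
  have hn : P.n ≤ 2 ^ P.L := P.n_lt.le
  have hT : P.T + 1 ≤ 2 ^ P.L := P.T_lt
  apply Nat.clog_le_of_le_pow
  have hcard : Fintype.card P.Code = (P.T + 1) * (P.V * (P.n * (P.V * (P.V * (P.V * P.V))) + 1)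
      ^ P.m) ^ P.k := by
    simp
  have he : P.n * (P.V * (P.V * (P.V * P.V))) + 1 ≤ 2 ^ (P.L + 4 * β + 1) := by
    have h1 : P.n * (P.V * (P.V * (P.V * P.V))) ≤ 2 ^ P.L * (2 ^ β * (2 ^ β * (2 ^ β * 2 ^ β))) := by
      gcongr
    have h2 : 2 ^ P.L * (2 ^ β * (2 ^ β * (2 ^ β * 2 ^ β))) = 2 ^ (P.L + 4 * β) := by
      simp only [← pow_add]
      congr 1
      ring
    have h3 : 1 ≤ 2 ^ (P.L + 4 * β) := Nat.one_le_two_pow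
    rw [pow_succ]
    omega
  rw [hcard]
  calc _ ≤ 2 ^ P.L * (2 ^ β * (2 ^ (P.L + 4 * β + 1)) ^ P.m) ^ P.k := by gcongr
    _ = _ := by
      simp only [← pow_mul, ← pow_add]
      congr 1
      ring

theorem length_experts_le {s : P.Memory} (hs : P.Small s) :
    (P.experts s.2).length ≤ 1 + P.k * P.m := by
  simp only [experts, List.length_cons, List.length_flatMap, List.length_map]
  have : ((List.range P.k).map fun j => (s.2 j).pool.length).sum ≤ (List.range P.k).length * P.m := by
    have h := List.sum_le_card_nsmul ((List.range P.k).map fun j => (s.2 j).pool.length) P.m (by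
      simp only [List.mem_map, List.mem_range]
      rintro x ⟨j, hj, rfl⟩
      exact (hs.2.1 j hj).2.1)
    simpa using h
  simp only [List.length_range] at this
  omega

/-- Every bit of the code occupies a word of its own; this wastes only a logarithmic factor. The
factor `q` comes from the pool size, and `L ^ 2` from the pool size times the bits of an entry. -/
theorem length_memoryWords_le {s : P.Memory} (hs : P.Small s) {c : ℕ} (hk : P.k ≤ c) :
    (P.memoryWords s).length ≤ (2 + 4 * c + 127 * c * (c + 1)) * (P.q * P.L ^ 2) := by
  have hL := P.L_pos
  have hq := P.q_pos
  have hm : P.m ≤ 4 * (P.q * P.L) := by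
    unfold m
    nlinarith [Nat.mul_le_mul hq hL]
  have h1 := P.length_experts_le hs
  have h2 := P.codeLength_le
  have hlen : (P.memoryWords s).length = (P.experts s.2).length + P.codeLength := by
    simp [memoryWords]
  have ha : P.L ≤ P.q * P.L ^ 2 := by
    calc P.L = 1 * (P.L * 1) := by ring
      _ ≤ P.q * (P.L * P.L) := Nat.mul_le_mul hq (Nat.mul_le_mul_left _ hL)
      _ = _ := by ring
  have hb : P.q * P.L ≤ P.q * P.L ^ 2 := by
    calc P.q * P.L = P.q * (P.L * 1) := by ring
      _ ≤ P.q * (P.L * P.L) := Nat.mul_le_mul_left _ (Nat.mul_le_mul_left _ hL)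
      _ = _ := by ring
  have h3 : P.L + 4 * (7 * P.L * (P.k + 1)) + 1 ≤ 30 * P.L * (c + 1) := by nlinarith
  calc (P.memoryWords s).length ≤ 1 + c * (4 * (P.q * P.L)) +
        (P.L + c * (7 * P.L * (c + 1) + 4 * (P.q * P.L) * (30 * P.L * (c + 1)))) := by
        rw [hlen]
        refine add_le_add (h1.trans ?_) (h2.trans ?_)
        · gcongr
        · gcongr
    _ = 1 + 4 * c * (P.q * P.L) + P.L + 7 * c * (c + 1) * P.L +
          120 * c * (c + 1) * (P.q * P.L ^ 2) := by ring
    _ ≤ P.q * P.L ^ 2 + 4 * c * (P.q * P.L ^ 2) + P.q * P.L ^ 2 +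
          7 * c * (c + 1) * (P.q * P.L ^ 2) + 120 * c * (c + 1) * (P.q * P.L ^ 2) := by
        gcongr
        omega
    _ = _ := by ring

/-- `n ^ k ≤ N ^ k ≤ T ≤ n ^ c`; for `n = 1` the base `N` is at most one and the logarithm is zero
by convention. -/
theorem k_le {c : ℕ} (h : P.T ≤ P.n ^ c) : P.k ≤ c := by
  rcases Nat.lt_or_ge 1 P.n with hn | hn
  · have h1 : P.n ^ P.k ≤ P.n ^ c := by
      calc P.n ^ P.k ≤ P.N ^ P.k := Nat.pow_le_pow_left (Nat.le_mul_of_pos_right _ P.q_pos) _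
        _ ≤ P.T := Nat.pow_log_le_self _ P.T_pos.ne'
        _ ≤ _ := h
    exact (Nat.pow_le_pow_iff_right hn).1 h1
  · have hN : P.N ≤ 1 := P.N_le.trans (by nlinarith)
    rw [k, Nat.log_of_left_le_one hN]
    exact Nat.zero_le _

/-! ### Regret -/

/-- The coins for choosing the followed expert (second coordinate `0`) never enter the memory, so
they are fresh given all pools. -/
theorem memory_update (l : ℕ → Fin P.n → ℕ) (ψ : P.Blocks) (c : Fin (P.T + 1) × Fin (P.k + 1))
    (hc : c.2 = 0) (u : P.Block) (t : ℕ) :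
    P.memory l (P.drawn (update ψ c u)) t = P.memory l (P.drawn ψ) t := by
  have : P.drawn (update ψ c u) = P.drawn ψ := by
    funext j d
    apply P.drawn_update_of_ne
    right
    rw [hc]
    simp
  rw [this]

theorem levelLoss_update (l : ℕ → Fin P.n → ℕ) (ψ : P.Blocks) (c : Fin (P.T + 1) × Fin (P.k + 1))
    (hc : c.2 = 0) (u : P.Block) (j t : ℕ) :
    P.levelLoss l (P.drawn (update ψ c u)) j t = P.levelLoss l (P.drawn ψ) j t := by
  apply congrFun
  apply P.levelLoss_congr
  intro j _
  funext d
  apply P.drawn_update_of_ne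
  right
  rw [hc]
  simp

/-- The block that serves for the choice of an expert on day `t`. -/
def playBlock (t : ℕ) : Fin (P.T + 1) × Fin (P.k + 1) := (⟨min (t + 1) P.T, by omega⟩, 0)

theorem playBlock_inj {s t : ℕ} (hs : s < P.T) (ht : t < P.T) (h : P.playBlock s = P.playBlock t) :
    s = t := by
  have := congrArg (fun z => z.1.val) h
  simp only [playBlock] at this
  omega

/-- The rounded loss of the followed expert on day `t`. -/
noncomputable def followedLoss (l : ℕ → Fin P.n → ℕ) (t : ℕ) (ψ : P.Blocks) : ℝ :=
  (l t (P.follow (P.memory l (P.drawn ψ) t).2 (ψ (P.playBlock t))) : ℝ) / P.T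

-- The concentration bound with deviation parameter `1 / √T`. Given the pools, the conditional mean
-- of a day is at most the loss of the top level plus the sampling error `n / card Block ≤ 1 / T`.
open scoped Classical in
theorem card_followedLoss_gt_le {l : ℕ → Fin P.n → ℕ} (hl : ∀ t i, l t i ≤ P.T) :
    (#{ψ : P.Blocks | ∑ t ∈ range P.T, ((P.levelLoss l (P.drawn ψ) P.k t : ℝ) / P.T + 1 / P.T) +
      (1 / √P.T) * P.T + (P.L : ℝ) ^ 2 / (1 / √P.T) < ∑ t ∈ range P.T, P.followedLoss l t ψ} : ℝ) ≤
      Real.exp (-(P.L : ℝ) ^ 2) * Fintype.card P.Blocks := by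
  have hT : (0 : ℝ) < P.T := by exact_mod_cast P.T_pos
  have hT1 : (1 : ℝ) ≤ P.T := by exact_mod_cast P.T_pos
  have hfrac : ∀ t i, (l t i : ℝ) / P.T ≤ 1 := fun t i => by
    rw [div_le_one hT]
    exact_mod_cast hl t i
  refine card_sum_gt_le P.T P.playBlock (P.followedLoss l)
    (fun t ψ => (P.levelLoss l (P.drawn ψ) P.k t : ℝ) / P.T + 1 / P.T) (1 / √P.T) _ (by positivity)
    ?_ (fun t _ ψ => by unfold followedLoss; positivity) (fun t _ ψ => hfrac _ _) ?_ ?_ ?_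
  · rw [div_le_one (by positivity)]
    exact Real.one_le_sqrt.2 hT1
  · intro s t ψ u _ _
    rw [P.levelLoss_update l ψ _ rfl]
  · intro s t ψ u hst ht
    unfold followedLoss
    rw [P.memory_update l ψ (P.playBlock t) rfl, update_of_ne]
    intro h
    have := P.playBlock_inj (by omega) ht h
    omega
  · intro t ht ψ
    unfold followedLoss
    have h0 : ∀ u, l t (P.follow (P.memory l (P.drawn (update ψ (P.playBlock t) u)) t).2 u) =
        l t (P.follow (P.memory l (P.drawn ψ) t).2 u) := fun u => by
      rw [P.memory_update l ψ (P.playBlock t) rfl]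
    simp only [update_self, h0]
    set s := (P.memory l (P.drawn ψ) t).2 with hs
    have h1 := (P.exists_follow s).choose_spec (fun i => (l t i : ℝ) / P.T)
      (fun i => by positivity) (fun i => hfrac t i)
    have h2 : ∑ i, P.dist s P.k i * ((l t i : ℝ) / P.T) ≤ P.levelLoss l (P.drawn ψ) P.k t / P.T := by
      have h3 := P.sum_dist_mul_le s (l t) P.k
      rw [hs, P.dayLoss_memory l (P.drawn ψ) t le_rfl, ← hs] at h3
      simp only [← mul_div_assoc]
      rw [← sum_div]
      gcongr
    have h4 : (P.n : ℝ) ≤ Fintype.card P.Block * (1 / P.T) := by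
      rw [mul_one_div, le_div_iff₀ hT]
      exact_mod_cast P.mul_le_card_block
    rw [mul_add]
    refine h1.trans (add_le_add ?_ h4)
    gcongr

theorem followedLoss_eq (x l : Fin P.T → Fin P.n → unitInterval) (ω : P.algorithm.Tape)
    (t : Fin P.T) : P.followedLoss (P.roundedLoss l) t (P.tapeBlocks ω) =
      (P.roundedLoss l t (P.algorithm.played x l ω t) : ℝ) / P.T := by
  rw [played_eq, followedLoss]
  have : P.playBlock t = (t.succ, 0) := by
    refine Prod.ext (Fin.ext ?_) rfl
    have := t.2
    simp only [playBlock, Fin.val_succ]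
    omega
  rw [this]

/-- The constant `2` is one unit for rounding the losses down and one for the sampling errors, each
at most `1 / T` a day. Rounding down only helps on the side of the comparator. -/
theorem regret_le_of_good (hn : 1 < P.n) (x l : Fin P.T → Fin P.n → unitInterval)
    (ω : P.algorithm.Tape) (i : Fin P.n)
    (hi : ∑ t, (l t i : ℝ) = ⨅ i : Fin P.n, ∑ t, (l t i : ℝ))
    (hfail : ∀ j < P.k, ∀ I < P.T, P.instanceFailures (P.roundedLoss l)
      (P.drawn (P.tapeBlocks ω)) i j I < 2 * P.n * P.L ^ 2)
    (hplay : ∑ t ∈ range P.T, P.followedLoss (P.roundedLoss l) t (P.tapeBlocks ω) ≤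
      ∑ t ∈ range P.T, ((P.levelLoss (P.roundedLoss l) (P.drawn (P.tapeBlocks ω)) P.k t : ℝ) / P.T +
        1 / P.T) + (1 / √P.T) * P.T + (P.L : ℝ) ^ 2 / (1 / √P.T)) :
    P.algorithm.regret x l ω ≤
      P.N * (P.n * (10 * P.L ^ 2)) ^ P.k + 2 + √P.T * (1 + P.L ^ 2) := by
  have hT : (0 : ℝ) < P.T := by exact_mod_cast P.T_pos
  have h1 := P.sum_topLoss_le hn (P.roundedLoss_le l) (P.roundedLoss_eq_zero l)
    (P.drawn (P.tapeBlocks ω)) i (fun j hj I => by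
      rcases Nat.lt_or_ge I P.T with hI | hI
      · exact (hfail j hj I hI).le
      · rw [P.instanceFailures_eq_zero _ _ _ hI]
        exact Nat.zero_le _)
  have hround : ∀ (t : Fin P.T) e, (P.roundedLoss l t e : ℝ) ≤ P.T * l t e ∧
      P.T * (l t e : ℝ) ≤ P.roundedLoss l t e + 1 := by
    intro t e
    rw [roundedLoss, dif_pos t.2]
    exact ⟨Nat.floor_le (mul_nonneg hT.le (l t e).2.1), (Nat.lt_floor_add_one _).le⟩
  have hone : ∑ _t : Fin P.T, (1 : ℝ) / P.T = 1 := by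
    simp only [sum_const, card_univ, Fintype.card_fin, nsmul_eq_mul]
    field_simp
  have h2 : ∑ t, (l t (P.algorithm.played x l ω t) : ℝ) ≤
      ∑ t ∈ range P.T, P.followedLoss (P.roundedLoss l) t (P.tapeBlocks ω) + 1 := by
    rw [← Fin.sum_univ_eq_sum_range
      (fun t => P.followedLoss (P.roundedLoss l) t (P.tapeBlocks ω)), ← hone, ← sum_add_distrib]
    refine sum_le_sum fun t _ => ?_
    rw [P.followedLoss_eq x, ← add_div, le_div_iff₀ hT, mul_comm]
    exact (hround t _).2
  have h3 : (∑ t ∈ range P.T, (P.levelLoss (P.roundedLoss l) (P.drawn (P.tapeBlocks ω)) P.k t : ℝ)) ≤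
      P.T * ∑ t, (l t i : ℝ) + P.R P.k := by
    have h4 : (∑ t ∈ range P.T, (P.roundedLoss l t i : ℝ)) ≤ P.T * ∑ t, (l t i : ℝ) := by
      rw [← Fin.sum_univ_eq_sum_range (fun t => (P.roundedLoss l t i : ℝ)), mul_sum]
      exact sum_le_sum fun t _ => (hround t i).1
    have h5 : (∑ t ∈ range P.T, (P.levelLoss (P.roundedLoss l) (P.drawn (P.tapeBlocks ω)) P.k t : ℝ)) ≤
        ∑ t ∈ range P.T, (P.roundedLoss l t i : ℝ) + P.R P.k := by exact_mod_cast h1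
    linarith
  have h6 : ∑ t ∈ range P.T, ((P.levelLoss (P.roundedLoss l) (P.drawn (P.tapeBlocks ω)) P.k t : ℝ) /
      P.T + 1 / P.T) ≤ ∑ t, (l t i : ℝ) + P.N * (P.n * (10 * P.L ^ 2)) ^ P.k + 1 := by
    have hR : (P.R P.k : ℝ) = P.T * (P.N * (P.n * (10 * P.L ^ 2)) ^ P.k) := by
      unfold R
      push_cast
      ring
    rw [sum_add_distrib, ← Fin.sum_univ_eq_sum_range (fun _ => (1 : ℝ) / P.T), hone, ← sum_div]
    gcongr
    rw [div_le_iff₀ hT]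
    rw [hR] at h3
    linarith
  have h7 : (1 / √(P.T : ℝ)) * P.T = √P.T := by
    rw [one_div_mul_eq_div, Real.div_sqrt]
  have h8 : (P.L : ℝ) ^ 2 / (1 / √(P.T : ℝ)) = √P.T * P.L ^ 2 := by
    rw [div_div_eq_mul_div, div_one, mul_comm]
  rw [h7, h8] at hplay
  rw [ExpertAlgorithm.regret, ← hi]
  linarith

/-- The regret bound fails with exponentially small probability. -/
theorem one_sub_le_prob_regret (hn : 1 < P.n) (x l : Fin P.T → Fin P.n → unitInterval) :
    1 - ((P.T : ℝ) ^ 2 + 1) * Real.exp (-(P.L : ℝ) ^ 2) ≤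
      P.algorithm.prob {ω | P.algorithm.regret x l ω ≤
        P.N * (P.n * (10 * P.L ^ 2)) ^ P.k + 2 + √P.T * (1 + P.L ^ 2)} := by
  classical
  obtain ⟨i, hi⟩ := exists_eq_ciInf_of_finite (f := fun i : Fin P.n => ∑ t, (l t i : ℝ))
  set bad : ℕ → ℕ → Finset P.Blocks := fun j I =>
    {ψ | 2 * P.n * P.L ^ 2 ≤ P.instanceFailures (P.roundedLoss l) (P.drawn ψ) i j I} with hbad
  set bad' : Finset P.Blocks := {ψ | ∑ t ∈ range P.T,
      ((P.levelLoss (P.roundedLoss l) (P.drawn ψ) P.k t : ℝ) / P.T + 1 / P.T) +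
      (1 / √P.T) * P.T + (P.L : ℝ) ^ 2 / (1 / √P.T) <
        ∑ t ∈ range P.T, P.followedLoss (P.roundedLoss l) t ψ} with hbad'
  set W : ℝ := Real.exp (-(P.L : ℝ) ^ 2) * Fintype.card P.Blocks with hW
  have hb : ∀ j < P.k, ∀ I, (#(bad j I) : ℝ) ≤ W := by
    intro j hj I
    refine (P.card_instanceFailures_le (P.roundedLoss l) i hj I _).trans ?_
    rw [hW]
    gcongr
    exact P.one_sub_pow_le
  have hb' : (#bad' : ℝ) ≤ W := P.card_followedLoss_gt_le (P.roundedLoss_le l)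
  have hk : P.k ≤ P.T := Nat.log_le_self _ _
  refine P.algorithm.one_sub_le_prob P.tapeBlocks _
    -- Union bound: too many failures in one of `k T` instances, or a large deviation of the
    -- followed losses; each event has probability at most `exp (-L²)`.
    (((range P.k ×ˢ range P.T).biUnion fun z => bad z.1 z.2) ∪ bad') (fun ω hω => ?_) _ ?_
  · simp only [mem_union, mem_biUnion, mem_product, mem_range,
      not_or, not_exists, not_and, hbad, hbad', mem_filter, mem_univ, true_and, not_le, not_lt,
      Prod.forall] at hω
    exact P.regret_le_of_good hn x l ω i hi (fun j hj I hI => hω.1 j I ⟨hj, hI⟩) hω.2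
  have h1 : (#(((range P.k ×ˢ range P.T).biUnion fun z => bad z.1 z.2) ∪ bad') : ℝ) ≤
      (P.k * P.T : ℝ) * W + W := by
    have h2 : (#((range P.k ×ˢ range P.T).biUnion fun z => bad z.1 z.2) : ℝ) ≤
        ∑ z ∈ range P.k ×ˢ range P.T, (#(bad z.1 z.2) : ℝ) := by
      exact_mod_cast card_biUnion_le
    have h3 : ∑ z ∈ range P.k ×ˢ range P.T, (#(bad z.1 z.2) : ℝ) ≤ (P.k * P.T : ℝ) * W := by
      refine (sum_le_card_nsmul _ _ W fun z hz => ?_).trans (le_of_eq ?_)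
      · exact hb _ (mem_range.1 (mem_product.1 hz).1) _
      · simp
    have h4 : (#(((range P.k ×ˢ range P.T).biUnion fun z => bad z.1 z.2) ∪ bad') : ℝ) ≤
        #((range P.k ×ˢ range P.T).biUnion fun z => bad z.1 z.2) + #bad' := by
      exact_mod_cast card_union_le _ _
    linarith
  refine h1.trans ?_
  have h6 : (P.k : ℝ) * P.T ≤ (P.T : ℝ) ^ 2 := by
    rw [sq]
    gcongr
  calc _ ≤ (P.T : ℝ) ^ 2 * W + W := by gcongr
    _ = _ := by rw [hW]; ring

end Params

/-! ### Asymptotic form of the bounds. -/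

namespace Params

open Finset

theorem L_le (P : Params) : (P.L : ℝ) ≤ 2 * (1 + Real.log ((P.n : ℝ) * P.T)) := by
  have hpos : P.n * P.T ≠ 0 := (Nat.mul_pos P.n_pos P.T_pos).ne'
  have h1 : (2 : ℝ) ^ Nat.log 2 (P.n * P.T) ≤ (P.n : ℝ) * P.T := by
    exact_mod_cast Nat.pow_log_le_self 2 hpos
  have h2 := Real.log_le_log (by positivity) h1
  rw [Real.log_pow] at h2
  have h3 := Real.log_two_gt_d9
  have h4 : (0 : ℝ) ≤ Nat.log 2 (P.n * P.T) := by positivity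
  rw [L]
  push_cast
  nlinarith

/-- The parameters for the exponent `δ`. -/
@[reducible]
noncomputable def ofExponent (δ : ℝ) (hδ : δ ∈ Set.Ioo (0 : ℝ) 1) (n T : ℕ+) : Params where
  n := n
  T := T
  q := ⌈(n : ℝ) ^ δ⌉₊
  n_pos := n.pos
  T_pos := T.pos
  q_pos := Nat.ceil_pos.2 (Real.rpow_pos_of_pos (by exact_mod_cast n.pos) δ)
  q_le := by
    apply Nat.ceil_le.2
    have hn : (1 : ℝ) ≤ ((n : ℕ) : ℝ) := by exact_mod_cast n.pos
    calc ((n : ℕ) : ℝ) ^ δ ≤ ((n : ℕ) : ℝ) ^ (1 : ℝ) := Real.rpow_le_rpow_of_exponent_le hn hδ.2.le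
      _ = _ := Real.rpow_one _

theorem spaceAtMost (δ : ℝ) (hδ : δ ∈ Set.Ioo (0 : ℝ) 1) (c : ℕ) (n T : ℕ+)
    (hT : (T : ℕ) ≤ (n : ℕ) ^ c) : (ofExponent δ hδ n T).algorithm.SpaceAtMost
      (8 * (2 + 4 * c + 127 * c * (c + 1)) * (n : ℝ) ^ δ *
        (1 + Real.log ((n : ℝ) * (T : ℝ))) ^ 2) := by
  set P := ofExponent δ hδ n T with hP
  intro x l ω t
  have hn : (1 : ℝ) ≤ (n : ℝ) := by exact_mod_cast n.pos
  have h1 : ((P.algorithm.words (P.algorithm.state x l ω t)).length : ℝ) ≤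
      (2 + 4 * c + 127 * c * (c + 1)) * (P.q * P.L ^ 2) := by
    exact_mod_cast P.length_memoryWords_le (P.algorithm.state x l ω t).2 (P.k_le hT)
  have hpow : (1 : ℝ) ≤ (n : ℝ) ^ δ := Real.one_le_rpow hn hδ.1.le
  have hq : (P.q : ℝ) ≤ 2 * (n : ℝ) ^ δ := by
    have := (Nat.ceil_lt_add_one (by linarith : (0 : ℝ) ≤ (n : ℝ) ^ δ)).le
    linarith
  have hL : (P.L : ℝ) ≤ 2 * (1 + Real.log ((n : ℝ) * (T : ℝ))) := P.L_le
  refine h1.trans ?_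
  calc (2 + 4 * c + 127 * c * (c + 1) : ℝ) * (P.q * P.L ^ 2)
      ≤ (2 + 4 * c + 127 * c * (c + 1)) *
        (2 * (n : ℝ) ^ δ * (2 * (1 + Real.log ((n : ℝ) * (T : ℝ)))) ^ 2) := by gcongr
    _ = _ := by ring

/-- `n ^ (1 + δ) ≤ N` and `N ^ k ≤ T`; take the root of order `1 + δ`. This is where the exponent of
`T` arises. -/
theorem pow_k_le_rpow (δ : ℝ) (hδ : δ ∈ Set.Ioo (0 : ℝ) 1) (n T : ℕ+) :
    (n : ℝ) ^ (ofExponent δ hδ n T).k ≤ (T : ℝ) ^ (1 / (1 + δ)) := by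
  set P := ofExponent δ hδ n T with hP
  have hn : (0 : ℝ) < (n : ℝ) := by exact_mod_cast n.pos
  have hδ1 : 0 < 1 + δ := by linarith [hδ.1]
  have h1 : (n : ℝ) ^ (1 + δ) ≤ P.N := by
    rw [Real.rpow_add hn, Real.rpow_one, N]
    push_cast
    gcongr
    exact Nat.le_ceil _
  have h2 : (P.N : ℝ) ^ P.k ≤ T := by
    exact_mod_cast Nat.pow_log_le_self P.N P.T_pos.ne'
  have h3 : ((n : ℝ) ^ P.k) ^ (1 + δ) ≤ T := by
    calc ((n : ℝ) ^ P.k) ^ (1 + δ) = ((n : ℝ) ^ (1 + δ)) ^ P.k := by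
          rw [← Real.rpow_natCast, ← Real.rpow_natCast, ← Real.rpow_mul hn.le,
            ← Real.rpow_mul hn.le, mul_comm]
      _ ≤ (P.N : ℝ) ^ P.k := by gcongr
      _ ≤ _ := h2
  calc (n : ℝ) ^ P.k = (((n : ℝ) ^ P.k) ^ (1 + δ)) ^ (1 / (1 + δ)) := by
        rw [← Real.rpow_mul (by positivity), mul_one_div_cancel hδ1.ne', Real.rpow_one]
    _ ≤ _ := by
        gcongr

theorem regretBound_le (δ : ℝ) (hδ : δ ∈ Set.Ioo (0 : ℝ) 1) (c : ℕ) (n T : ℕ+)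
    (hT : (T : ℕ) ≤ (n : ℕ) ^ c) (P : Params) (hP : P = ofExponent δ hδ n T) :
    (P.N : ℝ) * (P.n * (10 * P.L ^ 2)) ^ P.k + 2 + √P.T * (1 + P.L ^ 2) ≤
      (40 ^ c + 16) * (n : ℝ) ^ 2 * (T : ℝ) ^ (1 / (1 + δ)) *
        (1 + Real.log ((n : ℝ) * (T : ℝ))) ^ (2 * c + 2) := by
  set y : ℝ := 1 + Real.log ((n : ℝ) * (T : ℝ)) with hy
  set Y : ℝ := (T : ℝ) ^ (1 / (1 + δ)) with hY
  have hPn : (P.n : ℝ) = (n : ℝ) := by rw [hP]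
  have hPT : (P.T : ℝ) = (T : ℝ) := by rw [hP]
  have hn : (1 : ℝ) ≤ (n : ℝ) := by exact_mod_cast n.pos
  have hT1 : (1 : ℝ) ≤ (T : ℝ) := by exact_mod_cast T.pos
  have hδ0 := hδ.1
  have hy1 : 1 ≤ y := by
    have : 0 ≤ Real.log ((n : ℝ) * (T : ℝ)) := Real.log_nonneg (by nlinarith)
    linarith
  have hL : (P.L : ℝ) ≤ 2 * y := by
    have := P.L_le
    rwa [hPn, hPT] at this
  have hL1 : (1 : ℝ) ≤ P.L := by exact_mod_cast P.L_pos
  have hY1 : 1 ≤ Y := Real.one_le_rpow hT1 (by positivity)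
  have hk : P.k ≤ c := P.k_le (by rw [hP]; exact hT)
  have hkY : (n : ℝ) ^ P.k ≤ Y := by
    rw [hP]
    exact pow_k_le_rpow δ hδ n T
  have hN : (P.N : ℝ) ≤ (n : ℝ) ^ 2 := by
    rw [← hPn]
    exact_mod_cast P.N_le
  -- Because `δ < 1`, the sampling deviation `√T` is dominated by `T ^ (1 / (1 + δ))`.
  have hsqrt : √(P.T : ℝ) ≤ Y := by
    rw [hPT, Real.sqrt_eq_rpow]
    apply Real.rpow_le_rpow_of_exponent_le hT1
    apply one_div_le_one_div_of_le (by linarith)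
    linarith [hδ.2]
  have hLy : 10 * (P.L : ℝ) ^ 2 ≤ 40 * y ^ 2 := by nlinarith
  have h1 : (P.N : ℝ) * (P.n * (10 * P.L ^ 2)) ^ P.k ≤
      (n : ℝ) ^ 2 * Y * (40 ^ c * y ^ (2 * c + 2)) := by
    have h2 : (10 * (P.L : ℝ) ^ 2) ^ P.k ≤ 40 ^ c * y ^ (2 * c + 2) := by
      calc (10 * (P.L : ℝ) ^ 2) ^ P.k ≤ (40 * y ^ 2) ^ P.k := by gcongr
        _ ≤ (40 * y ^ 2) ^ c := pow_le_pow_right₀ (by nlinarith) hk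
        _ = 40 ^ c * y ^ (2 * c) := by rw [mul_pow, ← pow_mul]
        _ ≤ _ := by
          gcongr
          omega
    rw [mul_pow, hPn, ← mul_assoc]
    gcongr
  have h3 : 2 + √P.T * (1 + P.L ^ 2) ≤ (n : ℝ) ^ 2 * Y * (16 * y ^ (2 * c + 2)) := by
    have hy2 : y ^ 2 ≤ y ^ (2 * c + 2) := pow_le_pow_right₀ hy1 (by omega)
    have hn2 : 1 ≤ (n : ℝ) ^ 2 := one_le_pow₀ hn
    calc 2 + √(P.T : ℝ) * (1 + P.L ^ 2) ≤ 2 * Y + Y * (1 + P.L ^ 2) := by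
          gcongr
          linarith
      _ = Y * (3 + P.L ^ 2) := by ring
      _ ≤ Y * (16 * y ^ (2 * c + 2)) := by
          gcongr
          nlinarith
      _ = 1 * Y * (16 * y ^ (2 * c + 2)) := by ring
      _ ≤ _ := by gcongr
  calc _ ≤ (n : ℝ) ^ 2 * Y * (40 ^ c * y ^ (2 * c + 2)) +
        (n : ℝ) ^ 2 * Y * (16 * y ^ (2 * c + 2)) := by linarith
    _ = _ := by ring

/-- As `log T ≤ L`, the exponential is at least `T ^ (γ + 4)`; four powers of `T` absorb `T ^ 2 +
1`. -/
theorem failure_le (P : Params) (γ : ℕ) (hT : 2 ≤ P.T) (hL : γ + 4 ≤ P.L) :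
    ((P.T : ℝ) ^ 2 + 1) * Real.exp (-(P.L : ℝ) ^ 2) ≤ 1 / (P.T : ℝ) ^ γ := by
  have hT2 : (2 : ℝ) ≤ P.T := by exact_mod_cast hT
  have hT0 : (0 : ℝ) < P.T := by linarith
  have hL' : ((γ + 4 : ℕ) : ℝ) ≤ P.L := by exact_mod_cast hL
  have hlog := log_le_of_lt P.T_pos P.T_lt
  have hexp : (P.T : ℝ) ^ (γ + 4) ≤ Real.exp ((P.L : ℝ) ^ 2) := by
    rw [← Real.exp_log hT0, ← Real.exp_nat_mul]
    apply Real.exp_le_exp.2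
    rw [sq]
    gcongr
  rw [Real.exp_neg, ← div_eq_mul_inv, div_le_div_iff₀ (Real.exp_pos _) (by positivity), one_mul]
  refine le_trans ?_ hexp
  rw [pow_add, mul_comm]
  gcongr
  nlinarith [sq_nonneg ((P.T : ℝ) ^ 2 - 1)]

end Params

theorem theorem1 (δ : ℝ) (hδ : δ ∈ Set.Ioo (0 : ℝ) 1) :
    ∃ A : (n T : ℕ+) → ExpertAlgorithm n T, ∀ c : ℕ,
      (∃ (C : ℝ) (K : ℕ), ∀ n T : ℕ+, (T : ℕ) ≤ (n : ℕ) ^ c →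
        (A n T).SpaceAtMost
          (C * (n : ℝ) ^ δ * (1 + Real.log ((n : ℝ) * (T : ℝ))) ^ K)) ∧
      (∀ γ : ℕ, ∃ (C : ℝ) (K : ℕ), ∀ n T : ℕ+, (T : ℕ) ≤ (n : ℕ) ^ c →
        ∀ x l : Fin T → Fin n → unitInterval,
          1 - 1 / (T : ℝ) ^ γ ≤
            (A n T).prob {ω | (A n T).regret x l ω ≤
              C * (n : ℝ) ^ 2 * (T : ℝ) ^ (1 / (1 + δ)) *
                (1 + Real.log ((n : ℝ) * (T : ℝ))) ^ K}) := by
  refine ⟨fun n T => (Params.ofExponent δ hδ n T).algorithm, fun c =>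
    ⟨⟨_, 2, fun n T hT => Params.spaceAtMost δ hδ c n T hT⟩, fun γ =>
      ⟨40 ^ c + 16 + 2 ^ (γ + 4), 2 * c + 2, fun n T hT x l => ?_⟩⟩⟩
  set P := Params.ofExponent δ hδ n T with hP
  set y : ℝ := 1 + Real.log ((n : ℝ) * (T : ℝ)) with hy
  set Y : ℝ := (T : ℝ) ^ (1 / (1 + δ)) with hY
  have hn : (1 : ℝ) ≤ (n : ℝ) := by exact_mod_cast n.pos
  have hT1 : (1 : ℝ) ≤ (T : ℝ) := by exact_mod_cast T.pos
  have hδ0 := hδ.1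
  have hy1 : 1 ≤ y := by
    have : 0 ≤ Real.log ((n : ℝ) * (T : ℝ)) := Real.log_nonneg (by nlinarith)
    linarith
  have hY1 : 1 ≤ Y := Real.one_le_rpow hT1 (by positivity)
  have hone : 1 ≤ (n : ℝ) ^ 2 * Y * y ^ (2 * c + 2) :=
    one_le_mul_of_one_le_of_one_le (one_le_mul_of_one_le_of_one_le (one_le_pow₀ hn) hY1)
      (one_le_pow₀ hy1)
  -- For `T = 1` the claimed probability is zero. For `T ≥ 2` the hypothesis `T ≤ n ^ c` forces `n >
  -- 1`.
  rcases Nat.lt_or_ge (T : ℕ) 2 with hT2 | hT2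
  · have : (T : ℝ) = 1 := by
      have := T.pos
      exact_mod_cast (by omega : (T : ℕ) = 1)
    rw [this, one_pow, div_one, sub_self]
    exact P.algorithm.prob_nonneg _
  have hn1 : 1 < (n : ℕ) := by
    by_contra h
    have h1 : (n : ℕ) = 1 := by
      have := n.pos
      omega
    rw [h1, one_pow] at hT
    omega
  -- When the word length is too small for `failure_le`, `T` is at most `2 ^ (γ + 4)`, and the
  -- trivial bound regret `≤ T` is absorbed by that summand of the constant.
  rcases Nat.lt_or_ge P.L (γ + 4) with hL | hL
  · refine P.algorithm.one_sub_le_prob (Equiv.refl _) _ ∅ (fun ω _ => ?_) _ (by simp)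
    have h1 : ((T : ℕ) : ℝ) ≤ 2 ^ (γ + 4) := by
      exact_mod_cast P.T_lt.le.trans (Nat.pow_le_pow_right (by norm_num) hL.le)
    calc P.algorithm.regret x l ω ≤ ((T : ℕ) : ℝ) := P.algorithm.regret_le x l ω
      _ ≤ (2 : ℝ) ^ (γ + 4) * 1 := by linarith
      _ ≤ (40 ^ c + 16 + 2 ^ (γ + 4)) * ((n : ℝ) ^ 2 * Y * y ^ (2 * c + 2)) := by
          gcongr
          have : (0 : ℝ) ≤ 40 ^ c := by positivity
          linarith
      _ = _ := by ring
  · have h1 := P.one_sub_le_prob_regret hn1 x l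
    have h2 := P.failure_le γ hT2 hL
    have h3 := Params.regretBound_le δ hδ c n T hT P hP
    refine le_trans (by linarith : 1 - 1 / (T : ℝ) ^ γ ≤
      1 - ((P.T : ℝ) ^ 2 + 1) * Real.exp (-(P.L : ℝ) ^ 2)) (h1.trans ?_)
    refine MeasureTheory.measureReal_mono fun ω hω => ?_
    refine le_trans (le_trans hω h3) ?_
    have h4 : (40 ^ c + 16 : ℝ) ≤ 40 ^ c + 16 + 2 ^ (γ + 4) := le_add_of_nonneg_right (by positivity)
    rw [← hy, ← hY]
    exact mul_le_mul_of_nonneg_right (mul_le_mul_of_nonneg_right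
      (mul_le_mul_of_nonneg_right h4 (by positivity)) (by positivity)) (by positivity)
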